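/- All graphs are finite and simple. A \emph{search tree} on a connected graph $G$ is a rooted tree $T$ with vertex set $V(G)$, defined recursively: the root of $T$ is a vertex $r\in V(G)$, and the children of $r$ are the roots of search trees on the connected components of $G-r$ (one for each component). Let $v$ be a child of $u$ in a search tree $T$ on $G$. The \emph{rotation} of $u$ and $v$ in $T$ produces the search tree $T'$ on $G$ in which $v$ is a child of the parent of $u$ in $T$ (and $v$ is the root of $T'$ if $u$ is the root of $T$), $u$ is a child of $v$, every subtree of $u$ in $T$ other than the one rooted at $v$ remains a subtree of $u$, every subtree $S$ of $v$ in $T$ becomes a subtree of $u$ if $u$ is adjacent in $G$ to a vertex of $S$ and remains a subtree of $v$ otherwise, and everything else is unchanged. The \emph{rotation graph} $\mathcal R(G)$ has the search trees on $G$ as its vertices, two of them being adjacent if and only if they differ by one rotation. Let $K_{2,q}$ be the complete bipartite graph with parts of sizes $2$ and $q$. Then $$\operatorname{diam}\mathcal R(K_{2,3})=8,\quad \operatorname{diam}\mathcal R(K_{2,4})=11,\quad \operatorname{diam}\mathcal R(K_{2,5})=15,$$ $$\operatorname{diam}\mathcal R(K_{2,6})=20,\quad \operatorname{diam}\mathcal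 R(K_{2,7})=25,\quad \operatorname{diam}\mathcal R(K_{2,8})=30.$$ -/

import Mathlib

namespace GraphAssoc

/-- A rooted tree with vertex set `V`, given by its root and its parent map: the root has no
parent, and from every vertex the root is reached by passing to the parent finitely often. -/
@[ext]
structure RootedTree (V : Type*) where
  root : V
  parent : V → Option V
  parent_root : parent root = none
  reaches_root : ∀ v, Relation.ReflTransGen (fun a b => parent a = some b) v root

namespace RootedTree

variable {V : Type*}

/-- The vertex set of the subtree `T|v` of `T` rooted in `v`: all descendants of `v`,
including `v` itself. -/
def subtree (T : RootedTree V) (v : V) : Set V :=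
  {w | Relation.ReflTransGen (fun a b => T.parent a = some b) w v}

/-- The recursive clause of the definition of search trees: `T.IsSearchTreeOn G S r` says that
the part of `T` which hangs from `r` is a search tree, with root `r`, on the induced subgraph
`G[S]`. That is, `r ∈ S`, and for each connected component `C` of `G[S] - r` there is a child
`c C` of `r` which is the root of a search tree on `C`. -/
inductive IsSearchTreeOn (G : SimpleGraph V) (T : RootedTree V) : Set V → V → Prop
  | mk (S : Set V) (r : V) (hr : r ∈ S)
      (c : (G.induce (S \ {r})).ConnectedComponent → V)
      (hc : ∀ C, T.parent (c C) = some r)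
      (ih : ∀ C, IsSearchTreeOn G T (Subtype.val '' C.supp) (c C)) :
      IsSearchTreeOn G T S r

/-- `T` is a search tree on the (connected) graph `G`. -/
def IsSearchTree (G : SimpleGraph V) (T : RootedTree V) : Prop :=
  T.IsSearchTreeOn G Set.univ T.root

/-- `T'` is produced from `T` by the rotation of `u` and `v`, where `v` is a child of `u`:
* `v` takes the place of `u` below the former parent of `u` (`v` becomes the root if `u` was the
  root), and `u` becomes a child of `v`;
* a subtree `T|w` of `v` becomes a subtree of `u` if `u` is adjacent in `G` to a vertex of it,
  and stays a subtree of `v` otherwise;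
* every other vertex keeps its parent. -/
structure IsRotation (G : SimpleGraph V) (T T' : RootedTree V) (u v : V) : Prop where
  child : T.parent v = some u
  parent_fst : T'.parent u = some v
  parent_snd : T'.parent v = T.parent u
  parent_move : ∀ w, T.parent w = some v → (∃ x ∈ T.subtree w, G.Adj u x) →
    T'.parent w = some u
  parent_stay : ∀ w, T.parent w = some v → (¬ ∃ x ∈ T.subtree w, G.Adj u x) →
    T'.parent w = some v
  parent_other : ∀ w, w ≠ u → w ≠ v → T.parent w ≠ some v → T'.parent w = T.parent w

end RootedTree

/-- The rotation graph `R(G)` of a connected graph `G`: its vertices are the search trees on `G`,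
and two of them are adjacent iff they differ by one rotation. -/
def rotationGraph {V : Type*} (G : SimpleGraph V) :
    SimpleGraph {T : RootedTree V // T.IsSearchTree G} :=
  SimpleGraph.fromRel fun T T' => ∃ u v, RootedTree.IsRotation G T.1 T'.1 u v

end GraphAssoc

/-! The value is `(4 * q + q.choose 2 + 1) / 2`. Call the two vertices of the small part hubs, the
others items. A rotation never reverses the ancestor order of a pair other than the rotated one, so
distances can be estimated by counting pairs.

Upper bound (`edist_le`): let `a` and `a'` count the pairs (hub above item) in the two trees.
Pushing all hubs down, sorting the items and lifting the hubs again costs at most `a + q.choose 2 +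
a'`. Pulling all hubs up, swapping them if necessary and going back costs at most `(2q - a) + 1 +
(2q - a')`. The two costs add up to `4q + q.choose 2 + 1`, so one of them is at most half of that.

Lower bound (`length_ge`): take two path-shaped trees with opposite item orders and opposite hub
orders. A walk between them either passes through a tree with incomparable hubs, where every hub is
below every item, or rotates the two hubs, and then no item is between them (`exists_split`). Cut
the walk there. A pair of items escapes being rotated only if both items hang below both hubs at
some time in the same half, since only such items can be incomparable. Every item that gets so deep
costs extra hub rotations (`exists_cost_le_length`). If the numbers of items below the hubs are
balanced suitably, this never pays off, and the first route above is optimal. The balance is a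
finite condition on subsets of the items, checked for each `q`. -/

namespace GraphAssoc

/-! ### The ancestor order of a rooted tree. -/

namespace RootedTree

variable {V : Type*} {G : SimpleGraph V} {T T' : RootedTree V} {u v w x y p : V}

theorem mem_subtree_self (T : RootedTree V) (x : V) : x ∈ T.subtree x :=
  Relation.ReflTransGen.refl

theorem mem_subtree_trans (h₁ : w ∈ T.subtree x) (h₂ : x ∈ T.subtree y) : w ∈ T.subtree y :=
  Relation.ReflTransGen.trans h₁ h₂

theorem mem_subtree_of_parent (h : T.parent w = some x) : w ∈ T.subtree x :=
  Relation.ReflTransGen.single h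

theorem exists_parent (h : w ∈ T.subtree x) (hne : w ≠ x) :
    ∃ p, T.parent w = some p ∧ p ∈ T.subtree x := by
  rcases Relation.ReflTransGen.cases_head h with h | ⟨p, hp, h⟩
  · exact absurd h hne
  · exact ⟨p, hp, h⟩

theorem parent_mem_subtree (h : w ∈ T.subtree x) (hne : w ≠ x) (hp : T.parent w = some p) :
    p ∈ T.subtree x := by
  obtain ⟨p', hp', h'⟩ := exists_parent h hne
  rw [hp] at hp'
  cases hp'
  exact h'

theorem exists_child (h : w ∈ T.subtree x) (hne : w ≠ x) :
    ∃ c, T.parent c = some x ∧ w ∈ T.subtree c := by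
  rcases Relation.ReflTransGen.cases_tail h with h | ⟨c, h, hc⟩
  · exact absurd h.symm hne
  · exact ⟨c, hc, h⟩

theorem mem_subtree_root (T : RootedTree V) (w : V) : w ∈ T.subtree T.root :=
  T.reaches_root w

theorem not_transGen_self (T : RootedTree V) (w : V) :
    ¬ Relation.TransGen (fun a b => T.parent a = some b) w w := by
  refine Relation.ReflTransGen.head_induction_on
    (motive := fun w _ => ¬ Relation.TransGen (fun a b => T.parent a = some b) w w)
    (T.reaches_root w) ?_ ?_
  · intro h
    obtain ⟨c, hc, -⟩ := Relation.TransGen.head'_iff.1 h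
    simp [T.parent_root] at hc
  · intro a c hac _ ih h
    obtain ⟨c', hc', h'⟩ := Relation.TransGen.head'_iff.1 h
    simp only [hac, Option.some.injEq] at hc'
    subst hc'
    exact ih (Relation.TransGen.tail' h' hac)

theorem subtree_antisymm (h₁ : w ∈ T.subtree x) (h₂ : x ∈ T.subtree w) : w = x := by
  by_contra hne
  obtain ⟨p, hp, h⟩ := exists_parent h₁ hne
  exact T.not_transGen_self w (Relation.TransGen.head' hp (mem_subtree_trans h h₂))

theorem ne_of_parent (h : T.parent w = some x) : w ≠ x := by
  rintro rfl
  exact T.not_transGen_self w (Relation.TransGen.single h)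

theorem notMem_subtree_of_parent (h : T.parent w = some x) : x ∉ T.subtree w :=
  fun h' => ne_of_parent h (subtree_antisymm (mem_subtree_of_parent h) h')

theorem subtree_total (hx : w ∈ T.subtree x) (hy : w ∈ T.subtree y) :
    x ∈ T.subtree y ∨ y ∈ T.subtree x :=
  Relation.ReflTransGen.total_of_right_unique
    (fun _ _ _ h₁ h₂ => Option.some.inj (h₁.symm.trans h₂)) hx hy

theorem child_unique (hx : T.parent x = some p) (hy : T.parent y = some p)
    (hwx : w ∈ T.subtree x) (hwy : w ∈ T.subtree y) : x = y := by
  by_contra hne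
  rcases subtree_total hwx hwy with h | h
  · exact notMem_subtree_of_parent hy (parent_mem_subtree h hne hx)
  · exact notMem_subtree_of_parent hx (parent_mem_subtree h (Ne.symm hne) hy)

/-- The set of ancestors determines a rooted tree. -/
theorem eq_of_subtree_eq (h : ∀ x w, w ∈ T.subtree x ↔ w ∈ T'.subtree x) : T = T' := by
  have key : ∀ {T T' : RootedTree V}, (∀ x w, w ∈ T.subtree x ↔ w ∈ T'.subtree x) →
      ∀ w p, T.parent w = some p → T'.parent w = some p := by
    intro T T' h w p hp
    obtain ⟨p', hp', h'⟩ := exists_parent ((h p w).1 (mem_subtree_of_parent hp)) (ne_of_parent hp)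
    have h'' := parent_mem_subtree ((h p' w).2 (mem_subtree_of_parent hp')) (ne_of_parent hp') hp
    rw [hp', subtree_antisymm h' ((h _ _).1 h'')]
  refine RootedTree.ext ?_ ?_
  · exact subtree_antisymm ((h _ _).2 (T'.mem_subtree_root _)) (T.mem_subtree_root _)
  · funext w
    refine Option.ext fun p => ⟨key h w p, key (fun x w => (h x w).symm) w p⟩

/-- A walk down a tree from a vertex satisfying `P` to one not satisfying `P` uses an edge from a
vertex satisfying `P` to a child not satisfying it. -/
theorem exists_parent_step (P : V → Prop) (h : w ∈ T.subtree x) (hx : P x) (hw : ¬ P w) :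
    ∃ c p, T.parent c = some p ∧ P p ∧ ¬ P c ∧ p ∈ T.subtree x ∧ w ∈ T.subtree c := by
  induction h using Relation.ReflTransGen.head_induction_on with
  | refl => exact absurd hx hw
  | @head a c hac hc ih =>
    by_cases hPc : P c
    · exact ⟨a, c, hac, hPc, hw, hc, T.mem_subtree_self a⟩
    · obtain ⟨c', p', h₁, h₂, h₃, h₄, h₅⟩ := ih hPc
      exact ⟨c', p', h₁, h₂, h₃, h₄, mem_subtree_trans (mem_subtree_of_parent hac) h₅⟩

/-! ### Search trees in terms of the ancestor order. -/

/-- The description of search trees by their ancestor relation: adjacent vertices are comparable,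
and each vertex has a neighbour in the subtree of each of its children. -/
structure IsTight (G : SimpleGraph V) (T : RootedTree V) : Prop where
  comparable : ∀ x y, G.Adj x y → y ∈ T.subtree x ∨ x ∈ T.subtree y
  exists_adj : ∀ p w, T.parent w = some p → ∃ x ∈ T.subtree w, G.Adj p x

theorem IsSearchTreeOn.root_mem {S : Set V} {r : V} (h : T.IsSearchTreeOn G S r) : r ∈ S := by
  cases h; assumption

theorem IsSearchTreeOn.subset_subtree {S : Set V} {r : V} (h : T.IsSearchTreeOn G S r) :
    S ⊆ T.subtree r := by
  induction h with
  | mk S r hr c hc ih ih' =>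
    intro w hw
    by_cases hwr : w = r
    · subst hwr; exact T.mem_subtree_self w
    · exact mem_subtree_trans
        (ih' ((G.induce (S \ {r})).connectedComponentMk ⟨w, hw, hwr⟩) ⟨⟨w, hw, hwr⟩, rfl, rfl⟩)
        (mem_subtree_of_parent (hc _))

theorem IsSearchTreeOn.comparable {S : Set V} {r : V} (h : T.IsSearchTreeOn G S r) :
    ∀ x ∈ S, ∀ y ∈ S, G.Adj x y → y ∈ T.subtree x ∨ x ∈ T.subtree y := by
  have h₀ := h
  induction h with
  | mk S r hr c hc ih ih' =>
    intro x hx y hy hxy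
    by_cases hxr : x = r
    · subst hxr; exact Or.inl (h₀.subset_subtree hy)
    by_cases hyr : y = r
    · subst hyr; exact Or.inr (h₀.subset_subtree hx)
    refine ih' ((G.induce (S \ {r})).connectedComponentMk ⟨x, hx, hxr⟩) (ih _) x
      ⟨⟨x, hx, hxr⟩, rfl, rfl⟩ y ⟨⟨y, hy, hyr⟩, ?_, rfl⟩ hxy
    refine SimpleGraph.ConnectedComponent.sound (SimpleGraph.Adj.reachable ?_)
    exact hxy.symm

/-- Connectedness of the subgraph induced by `S`, with the paths spelled out. -/
def ConnectedOn (G : SimpleGraph V) (S : Set V) : Prop :=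
  ∀ x ∈ S, ∀ y ∈ S, Relation.ReflTransGen (fun a b => G.Adj a b ∧ a ∈ S ∧ b ∈ S) x y

theorem connectedOn_component {S : Set V} (C : (G.induce S).ConnectedComponent) :
    ConnectedOn G (Subtype.val '' C.supp) := by
  rintro _ ⟨x, hx, rfl⟩ _ ⟨y, hy, rfl⟩
  obtain ⟨q⟩ : (G.induce S).Reachable x y :=
    SimpleGraph.ConnectedComponent.exact (hx.trans hy.symm)
  induction q with
  | nil => exact Relation.ReflTransGen.refl
  | @cons a b c hab q ih =>
    have hb : b ∈ C.supp :=
      (SimpleGraph.ConnectedComponent.sound (SimpleGraph.Adj.reachable hab.symm)).trans hx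
    exact Relation.ReflTransGen.head ⟨hab, ⟨a, hx, rfl⟩, ⟨b, hb, rfl⟩⟩ (ih hb hy)

/-- A path from the component to `r` inside `S` can leave the component only by stepping onto `r`.
-/
theorem exists_adj_component {S : Set V} {r : V} (hS : ConnectedOn G S) (hr : r ∈ S)
    (C : (G.induce (S \ {r})).ConnectedComponent) :
    ∃ x ∈ Subtype.val '' C.supp, G.Adj r x := by
  obtain ⟨⟨w, hw, hwr⟩, hC⟩ := C.exists_rep
  have hpath := hS w hw r hr
  have key : ∀ w, Relation.ReflTransGen (fun a b => G.Adj a b ∧ a ∈ S ∧ b ∈ S) w r →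
      w ∈ Subtype.val '' C.supp → ∃ x ∈ Subtype.val '' C.supp, G.Adj r x := by
    intro w h
    induction h using Relation.ReflTransGen.head_induction_on with
    | refl =>
      rintro ⟨x, -, hx⟩
      exact absurd hx x.2.2
    | @head a b hab h ih =>
      intro ha
      by_cases hbr : b = r
      · subst hbr; exact ⟨a, ha, hab.1.symm⟩
      · obtain ⟨a', ha', rfl⟩ := ha
        refine ih ⟨⟨b, hab.2.2, hbr⟩, ?_, rfl⟩
        refine (SimpleGraph.ConnectedComponent.sound (SimpleGraph.Adj.reachable ?_)).trans ha'
        exact hab.1.symm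
  exact key w hpath ⟨⟨w, hw, hwr⟩, hC, rfl⟩

theorem IsSearchTreeOn.exists_adj {S : Set V} {r : V} (h : T.IsSearchTreeOn G S r)
    (hS : ConnectedOn G S) : ∀ p ∈ S, ∀ w ∈ S, T.parent w = some p →
      ∃ x ∈ T.subtree w, G.Adj p x := by
  induction h with
  | mk S r hr c hc ih ih' =>
    intro p hp w hw hpw
    have hsub : ∀ C, Subtype.val '' C.supp ⊆ T.subtree (c C) := fun C => (ih C).subset_subtree
    have hwr : w ≠ r := by
      rintro rfl
      by_cases hpw' : p = w
      · exact ne_of_parent hpw hpw'.symm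
      · refine notMem_subtree_of_parent hpw (mem_subtree_trans
          (hsub ((G.induce (S \ {w})).connectedComponentMk ⟨p, hp, hpw'⟩) ⟨⟨p, hp, hpw'⟩, rfl, rfl⟩)
          (mem_subtree_of_parent (hc _)))
    obtain ⟨C, hC⟩ : ∃ C, C = (G.induce (S \ {r})).connectedComponentMk ⟨w, hw, hwr⟩ := ⟨_, rfl⟩
    have hwC : w ∈ Subtype.val '' C.supp := ⟨⟨w, hw, hwr⟩, hC.symm, rfl⟩
    by_cases hpr : p = r
    · subst hpr
      obtain rfl := child_unique hpw (hc C) (T.mem_subtree_self w) (hsub C hwC)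
      obtain ⟨x, hx, hadj⟩ := exists_adj_component hS hr C
      exact ⟨x, hsub C hx, hadj⟩
    · refine ih' C (connectedOn_component C) p ?_ w hwC hpw
      obtain ⟨C', hC'⟩ : ∃ C, C = (G.induce (S \ {r})).connectedComponentMk ⟨p, hp, hpr⟩ := ⟨_, rfl⟩
      have hpC : p ∈ Subtype.val '' C'.supp := ⟨⟨p, hp, hpr⟩, hC'.symm, rfl⟩
      -- `w` lies below the roots of both components, so these roots agree; each root lies in its
      -- own component, hence the components agree too.
      have hcc : c C = c C' := child_unique (hc C) (hc C') (hsub C hwC)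
        (mem_subtree_trans (mem_subtree_of_parent hpw) (hsub C' hpC))
      have h₁ := (ih C).root_mem
      have h₂ := (ih C').root_mem
      rw [← hcc] at h₂
      obtain ⟨z, hz, hz'⟩ := h₁
      obtain ⟨z', hzz, hzz'⟩ := h₂
      obtain rfl : z = z' := Subtype.ext (hz'.trans hzz'.symm)
      have : C = C' := hz.symm.trans hzz
      rwa [this]

theorem IsSearchTree.isTight (hG : ConnectedOn G Set.univ) (h : T.IsSearchTree G) :
    T.IsTight G where
  comparable x y := IsSearchTreeOn.comparable h x trivial y trivial
  exists_adj p w := IsSearchTreeOn.exists_adj h hG p trivial w trivial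

/-- Justifies induction from the leaves upwards. -/
theorem wellFounded_transGen_child [Finite V] (T : RootedTree V) :
    WellFounded (Relation.TransGen (fun a b => T.parent a = some b)) :=
  haveI : IsTrans V (Relation.TransGen (fun a b => T.parent a = some b)) :=
    ⟨fun _ _ _ => Relation.TransGen.trans⟩
  haveI : Std.Irrefl (Relation.TransGen (fun a b => T.parent a = some b)) :=
    ⟨T.not_transGen_self⟩
  Finite.wellFounded_of_trans_of_irrefl _

theorem IsTight.reach [Finite V] (h : T.IsTight G) (c : V) : ∀ x ∈ T.subtree c,
    Relation.ReflTransGen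
      (fun a b => G.Adj a b ∧ a ∈ T.subtree c ∧ b ∈ T.subtree c) x c := by
  induction c using T.wellFounded_transGen_child.induction with
  | _ c ih =>
    intro x hx
    by_cases hxc : x = c
    · subst hxc; exact Relation.ReflTransGen.refl
    obtain ⟨d, hd, hxd⟩ := exists_child hx hxc
    obtain ⟨y, hy, hcy⟩ := h.exists_adj c d hd
    have hdc := mem_subtree_of_parent hd
    have mono : ∀ a b, Relation.ReflTransGen
        (fun a b => G.Adj a b ∧ a ∈ T.subtree d ∧ b ∈ T.subtree d) a b → Relation.ReflTransGen
        (fun a b => G.Adj a b ∧ a ∈ T.subtree c ∧ b ∈ T.subtree c) a b :=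
      Relation.ReflTransGen.mono fun a b hab =>
        ⟨hab.1, mem_subtree_trans hab.2.1 hdc, mem_subtree_trans hab.2.2 hdc⟩
    have h₁ := mono _ _ (ih d (Relation.TransGen.single hd) x hxd)
    have : Std.Symm (fun a b => G.Adj a b ∧ a ∈ T.subtree d ∧ b ∈ T.subtree d) :=
      ⟨fun a b hab => ⟨hab.1.symm, hab.2.2, hab.2.1⟩⟩
    have h₂ := mono _ _ (Std.Symm.symm _ _ (ih d (Relation.TransGen.single hd) y hy))
    exact (h₁.trans h₂).tail ⟨hcy.symm, mem_subtree_trans hy hdc, T.mem_subtree_self c⟩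

/-- The components left after deleting `r` are exactly the subtrees of its children: comparability
forbids edges between different child subtrees, and `IsTight.reach` makes each of them connected. -/
theorem IsTight.isSearchTreeOn [Finite V] (h : T.IsTight G) (r : V) :
    T.IsSearchTreeOn G (T.subtree r) r := by
  induction r using T.wellFounded_transGen_child.induction with
  | _ r ih =>
    have key : ∀ C : (G.induce (T.subtree r \ {r})).ConnectedComponent,
        ∃ c, T.parent c = some r ∧ Subtype.val '' C.supp = T.subtree c := by
      intro C
      obtain ⟨⟨w, hw, hwr⟩, hC⟩ := C.exists_rep
      obtain ⟨c, hc, hwc⟩ := exists_child hw hwr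
      have hsub : ∀ z ∈ T.subtree c, z ∈ T.subtree r \ {r} := fun z hz =>
        ⟨mem_subtree_trans hz (mem_subtree_of_parent hc), by
          rintro rfl; exact notMem_subtree_of_parent hc hz⟩
      refine ⟨c, hc, Set.Subset.antisymm ?_ ?_⟩
      · rintro _ ⟨x, hx, rfl⟩
        obtain ⟨q⟩ : (G.induce (T.subtree r \ {r})).Reachable ⟨w, hw, hwr⟩ x :=
          SimpleGraph.ConnectedComponent.exact (hC.trans hx.symm)
        have step : ∀ a b : ↥(T.subtree r \ {r}), (G.induce (T.subtree r \ {r})).Walk a b →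
            a.1 ∈ T.subtree c → b.1 ∈ T.subtree c := by
          intro a b q
          induction q with
          | nil => exact id
          | @cons a b d hab _ ih =>
            intro ha
            refine ih ?_
            rcases h.comparable a.1 b.1 hab with hb | hb
            · exact mem_subtree_trans hb ha
            · rcases subtree_total hb ha with hb' | hb'
              · exact hb'
              · by_cases hcb : c = b.1
                · rw [hcb]; exact T.mem_subtree_self _
                · exact absurd (subtree_antisymm b.2.1 (parent_mem_subtree hb' hcb hc)) b.2.2
        exact step _ _ q hwc
      · have hreach : ∀ x (hx : x ∈ T.subtree c), (G.induce (T.subtree r \ {r})).Reachable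
            ⟨x, hsub x hx⟩ ⟨c, hsub c (T.mem_subtree_self c)⟩ := by
          intro x hx
          have := h.reach c x hx
          induction this using Relation.ReflTransGen.head_induction_on with
          | refl => exact SimpleGraph.Reachable.refl _
          | @head a b hab _ ih =>
            refine SimpleGraph.Reachable.trans (SimpleGraph.Adj.reachable ?_) (ih hab.2.2)
            exact hab.1
        intro x hx
        refine ⟨⟨x, hsub x hx⟩, ?_, rfl⟩
        exact (SimpleGraph.ConnectedComponent.sound
          ((hreach x hx).trans (hreach w hwc).symm)).trans hC
    choose c hc hC using key
    refine IsSearchTreeOn.mk _ r (T.mem_subtree_self r) c hc fun C => ?_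
    rw [hC]
    exact ih _ (Relation.TransGen.single (hc C))

theorem IsTight.isSearchTree [Finite V] (h : T.IsTight G) : T.IsSearchTree G := by
  have := h.isSearchTreeOn T.root
  rwa [show T.subtree T.root = Set.univ from Set.eq_univ_of_forall T.mem_subtree_root] at this

/-! ### The effect of a rotation on the ancestor order. -/

section Rotation

/-- Only `v` can gain descendants, and it gains them from the subtree of `u`. -/
theorem IsRotation.mem_subtree (h : IsRotation G T T' u v) (hw : w ∈ T'.subtree x) :
    w ∈ T.subtree x ∨ x = v ∧ w ∈ T.subtree u := by
  have hvu := mem_subtree_of_parent h.child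
  induction hw using Relation.ReflTransGen.head_induction_on with
  | refl => exact Or.inl (T.mem_subtree_self x)
  | @head a p hap _ ih =>
    by_cases hau : a = u
    · subst hau
      rw [h.parent_fst, Option.some.injEq] at hap
      subst hap
      by_cases hxv : x = v
      · exact Or.inr ⟨hxv, T.mem_subtree_self _⟩
      · rcases ih with ih | ih
        · exact Or.inl (parent_mem_subtree ih (Ne.symm hxv) h.child)
        · exact absurd ih.1 hxv
    by_cases hav : a = v
    · subst hav
      rw [h.parent_snd] at hap
      rcases ih with ih | ih
      · exact Or.inl (mem_subtree_trans hvu (mem_subtree_trans (mem_subtree_of_parent hap) ih))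
      · exact Or.inr ⟨ih.1, hvu⟩
    by_cases hpa : T.parent a = some v
    · have hav := mem_subtree_of_parent hpa
      by_cases hm : ∃ x ∈ T.subtree a, G.Adj u x
      · rw [h.parent_move a hpa hm, Option.some.injEq] at hap
        subst hap
        rcases ih with ih | ih
        · exact Or.inl (mem_subtree_trans hav (mem_subtree_trans hvu ih))
        · exact Or.inr ⟨ih.1, mem_subtree_trans hav hvu⟩
      · rw [h.parent_stay a hpa hm, Option.some.injEq] at hap
        subst hap
        rcases ih with ih | ih
        · exact Or.inl (mem_subtree_trans hav ih)
        · exact Or.inr ⟨ih.1, mem_subtree_trans hav hvu⟩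
    · rw [h.parent_other a hau hav hpa] at hap
      have hap := mem_subtree_of_parent hap
      rcases ih with ih | ih
      · exact Or.inl (mem_subtree_trans hap ih)
      · exact Or.inr ⟨ih.1, mem_subtree_trans hap ih.2⟩

/-- A rotation reverses the order of no pair of vertices other than the rotated one. -/
theorem IsRotation.eq_of_reversed (h : IsRotation G T T' u v) (hne : x ≠ w)
    (hw : w ∈ T.subtree x) (hx : x ∈ T'.subtree w) : x = u ∧ w = v := by
  rcases h.mem_subtree hx with hx | ⟨rfl, hx⟩
  · exact absurd (subtree_antisymm hx hw) hne
  · exact ⟨subtree_antisymm hx (parent_mem_subtree hw (Ne.symm hne) h.child), rfl⟩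

theorem IsRotation.fst_mem (h : IsRotation G T T' u v) : u ∈ T'.subtree v :=
  mem_subtree_of_parent h.parent_fst

/-- Only `u` can lose descendants. -/
theorem IsRotation.subtree_subset (h : IsRotation G T T' u v) (hx : x ≠ u) :
    T.subtree x ⊆ T'.subtree x := by
  intro w hw
  have huv : u ∈ T'.subtree v := h.fst_mem
  induction hw using Relation.ReflTransGen.head_induction_on with
  | refl => exact T'.mem_subtree_self x
  | @head a p hap _ ih =>
    by_cases hau : a = u
    · subst hau
      rw [← h.parent_snd] at hap
      exact mem_subtree_trans huv (mem_subtree_trans (mem_subtree_of_parent hap) ih)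
    by_cases hav : a = v
    · subst hav
      rw [h.child, Option.some.injEq] at hap
      subst hap
      exact parent_mem_subtree ih (Ne.symm hx) h.parent_fst
    by_cases hpa : T.parent a = some v
    · obtain rfl : v = p := Option.some.inj (hpa.symm.trans hap)
      by_cases hm : ∃ x ∈ T.subtree a, G.Adj u x
      · exact mem_subtree_trans (mem_subtree_of_parent (h.parent_move a hpa hm))
          (mem_subtree_trans huv ih)
      · exact mem_subtree_trans (mem_subtree_of_parent (h.parent_stay a hpa hm)) ih
    · rw [← h.parent_other a hau hav hpa] at hap
      exact mem_subtree_trans (mem_subtree_of_parent hap) ih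

theorem IsRotation.mem_subtree_fst (h : IsRotation G T T' u v) (hw : w ∈ T.subtree u)
    (hwv : w ∉ T.subtree v) : w ∈ T'.subtree u := by
  induction hw using Relation.ReflTransGen.head_induction_on with
  | refl => exact T'.mem_subtree_self u
  | @head a p hap _ ih =>
    by_cases hau : a = u
    · subst hau; exact T'.mem_subtree_self _
    have hp : p ∉ T.subtree v := fun hp =>
      hwv (mem_subtree_trans (mem_subtree_of_parent hap) hp)
    have hav : a ≠ v := by rintro rfl; exact hwv (T.mem_subtree_self _)
    have hpv : T.parent a ≠ some v := fun hpa => hwv (mem_subtree_of_parent hpa)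
    rw [← h.parent_other a hau hav hpv] at hap
    exact mem_subtree_trans (mem_subtree_of_parent hap) (ih hp)

theorem IsRotation.subtree_subset_fst (h : IsRotation G T T' u v) (hw : T.parent w = some v)
    (hm : ∃ x ∈ T.subtree w, G.Adj u x) : T.subtree w ⊆ T'.subtree u := by
  have hwu : w ≠ u := by
    rintro rfl
    exact notMem_subtree_of_parent h.child (mem_subtree_of_parent hw)
  exact fun y hy => mem_subtree_trans (h.subtree_subset hwu hy)
    (mem_subtree_of_parent (h.parent_move w hw hm))

/-- The descendants lost by `u` are `v` and the subtrees of `v` without a neighbour of `u`. So an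
edge at `u` loses comparability at most when it goes to `v`, and that pair is merely reversed. -/
theorem IsRotation.isTight (h : IsRotation G T T' u v) (hT : T.IsTight G) : T'.IsTight G := by
  have hcomp : ∀ x y, G.Adj x y → y ∈ T.subtree x → y ∈ T'.subtree x ∨ x ∈ T'.subtree y := by
    intro x y hxy hy
    by_cases hxu : x = u
    · subst hxu
      by_cases hyv : y ∈ T.subtree v
      · by_cases hyv' : y = v
        · subst hyv'; exact Or.inr h.fst_mem
        · obtain ⟨c, hc, hyc⟩ := exists_child hyv hyv'
          exact Or.inl (h.subtree_subset_fst hc ⟨y, hyc, hxy⟩ hyc)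
      · exact Or.inl (h.mem_subtree_fst hy hyv)
    · exact Or.inl (h.subtree_subset hxu hy)
  refine ⟨fun x y hxy => ?_, fun p w hpw => ?_⟩
  · rcases hT.comparable x y hxy with hy | hx
    · exact hcomp x y hxy hy
    · exact (hcomp y x hxy.symm hx).symm
  · have huv : u ≠ v := (ne_of_parent h.child).symm
    by_cases hwu : w = u
    · subst hwu
      rw [h.parent_fst, Option.some.injEq] at hpw
      subst hpw
      obtain ⟨y, hy, hwy⟩ := hT.exists_adj _ _ h.child
      by_cases hyv : y = v
      · subst hyv; exact ⟨w, T'.mem_subtree_self w, hwy.symm⟩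
      · obtain ⟨c, hc, hyc⟩ := exists_child hy hyv
        obtain ⟨z, hz, hvz⟩ := hT.exists_adj _ _ hc
        exact ⟨z, h.subtree_subset_fst hc ⟨y, hyc, hwy⟩ hz, hvz⟩
    have hsub := h.subtree_subset hwu
    by_cases hwv : w = v
    · subst hwv
      rw [h.parent_snd] at hpw
      obtain ⟨y, hy, hpy⟩ := hT.exists_adj _ _ hpw
      refine ⟨y, ?_, hpy⟩
      by_cases hyw : y ∈ T.subtree w
      · exact hsub hyw
      · exact mem_subtree_trans (h.mem_subtree_fst hy hyw) h.fst_mem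
    by_cases hpv : T.parent w = some v
    · by_cases hm : ∃ x ∈ T.subtree w, G.Adj u x
      · rw [h.parent_move w hpv hm, Option.some.injEq] at hpw
        subst hpw
        obtain ⟨x, hx, hux⟩ := hm
        exact ⟨x, hsub hx, hux⟩
      · rw [h.parent_stay w hpv hm, Option.some.injEq] at hpw
        subst hpw
        obtain ⟨x, hx, hux⟩ := hT.exists_adj _ _ hpv
        exact ⟨x, hsub hx, hux⟩
    · rw [h.parent_other w hwu hwv hpv] at hpw
      obtain ⟨x, hx, hux⟩ := hT.exists_adj _ _ hpw
      exact ⟨x, hsub hx, hux⟩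

theorem exists_isRotation (G : SimpleGraph V) (h : T.parent v = some u) :
    ∃ T', IsRotation G T T' u v := by
  classical
  have hvu : v ≠ u := ne_of_parent h
  let par : V → Option V := fun w =>
    if w = u then some v else if w = v then T.parent u
    else if T.parent w = some v ∧ ∃ x ∈ T.subtree w, G.Adj u x then some u else T.parent w
  let rt : V := if u = T.root then v else T.root
  have par_u : par u = some v := by simp [par]
  have par_v : par v = T.parent u := by simp [par, hvu]
  have par_other : ∀ w, w ≠ u → w ≠ v → T.parent w ≠ some v → par w = T.parent w := by
    intro w h₁ h₂ h₃; simp [par, h₁, h₂, h₃]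
  have root_ne : T.root ≠ v := by
    intro hv
    rw [← hv, T.parent_root] at h
    cases h
  -- Outside the subtree of `u` parents are unchanged, so the old path to the root survives.
  have outside : ∀ y, y ∉ T.subtree u → Relation.ReflTransGen (fun a b => par a = some b) y rt := by
    intro y
    refine Relation.ReflTransGen.head_induction_on
      (motive := fun y _ => y ∉ T.subtree u →
        Relation.ReflTransGen (fun a b => par a = some b) y rt) (T.reaches_root y) ?_ ?_
    · intro hr
      have : u ≠ T.root := by rintro rfl; exact hr (T.mem_subtree_self _)
      simp only [rt, this, if_false]
      exact Relation.ReflTransGen.refl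
    · intro a p hap _ ih ha
      have hav : ∀ z, a = z ∨ T.parent a = some z → z ∉ T.subtree u := by
        rintro z (rfl | hz) hz'
        · exact ha hz'
        · exact ha (mem_subtree_trans (mem_subtree_of_parent hz) hz')
      have hv := mem_subtree_of_parent h
      refine Relation.ReflTransGen.head ?_ (ih (hav p (Or.inr hap)))
      rw [par_other a (by rintro rfl; exact ha (T.mem_subtree_self _))
        (fun e => hav v (Or.inl e) hv) (fun e => hav v (Or.inr e) hv), hap]
  have reach_v : Relation.ReflTransGen (fun a b => par a = some b) v rt := by
    by_cases hu : u = T.root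
    · simp only [rt, hu, if_true]; exact Relation.ReflTransGen.refl
    · obtain ⟨p, hp, -⟩ := exists_parent (T.mem_subtree_root u) hu
      exact Relation.ReflTransGen.head (par_v.trans hp) (outside p (notMem_subtree_of_parent hp))
  have reach_u : Relation.ReflTransGen (fun a b => par a = some b) u rt :=
    Relation.ReflTransGen.head par_u reach_v
  refine ⟨⟨rt, par, ?_, fun w => ?_⟩, h, par_u, par_v, ?_, ?_, par_other⟩
  · by_cases hu : u = T.root
    · rw [show rt = v from if_pos hu, par_v, hu, T.parent_root]
    · rw [show rt = T.root from if_neg hu]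
      simp [par, Ne.symm hu, root_ne, T.parent_root]
  · refine Relation.ReflTransGen.head_induction_on
      (motive := fun y _ => Relation.ReflTransGen (fun a b => par a = some b) y rt)
      (T.reaches_root w) ?_ ?_
    · by_cases hu : u = T.root
      · rw [← hu]; exact reach_u
      · simp only [rt, hu, if_false]; exact Relation.ReflTransGen.refl
    · intro a p hap _ ih
      by_cases hau : a = u
      · subst hau; exact reach_u
      by_cases hav : a = v
      · subst hav; exact reach_v
      by_cases hm : T.parent a = some v ∧ ∃ x ∈ T.subtree a, G.Adj u x
      · exact Relation.ReflTransGen.head (by simp [par, hau, hav, hm]) reach_u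
      · exact Relation.ReflTransGen.head
          (show par a = some p by simp only [par, hau, hav, hm, if_false]; exact hap) ih
  · intro w hw hm
    have hwu : w ≠ u := by
      rintro rfl
      exact notMem_subtree_of_parent h (mem_subtree_of_parent hw)
    simp only [par, hwu, ne_of_parent hw, if_false]
    rw [if_pos ⟨hw, hm⟩]
  · intro w hw hm
    have hwu : w ≠ u := by
      rintro rfl
      exact notMem_subtree_of_parent h (mem_subtree_of_parent hw)
    simp only [par, hwu, ne_of_parent hw, if_false]
    rw [if_neg (fun h => hm h.2), hw]


/-- A rotation can make a pair comparable or incomparable, so comparability is needed in both trees;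
then only a reversal could change the order. -/
theorem IsRotation.mem_subtree_iff (h : IsRotation G T T' u v) (hne : x ≠ w)
    (h₁ : ¬ (u = x ∧ v = w)) (h₂ : ¬ (u = w ∧ v = x))
    (hT : w ∈ T.subtree x ∨ x ∈ T.subtree w) (hT' : w ∈ T'.subtree x ∨ x ∈ T'.subtree w) :
    w ∈ T.subtree x ↔ w ∈ T'.subtree x := by
  constructor
  · intro hw
    rcases hT' with h' | h'
    · exact h'
    · obtain ⟨rfl, rfl⟩ := h.eq_of_reversed hne hw h'
      exact absurd ⟨rfl, rfl⟩ h₁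
  · intro hw
    rcases hT with h' | h'
    · exact h'
    · obtain ⟨rfl, rfl⟩ := h.eq_of_reversed (Ne.symm hne) h' hw
      exact absurd ⟨rfl, rfl⟩ h₂

theorem IsTight.exists_adj_of_ne (h : T.IsTight G) (hx : x ∈ T.subtree w) (hne : x ≠ w) :
    ∃ y ∈ T.subtree w, y ≠ w ∧ G.Adj w y := by
  obtain ⟨c, hc, -⟩ := exists_child hx hne
  obtain ⟨y, hy, hwy⟩ := h.exists_adj w c hc
  exact ⟨y, mem_subtree_trans hy (mem_subtree_of_parent hc), hwy.ne', hwy⟩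

end Rotation

/-! ### Path-shaped trees. -/

/-- An injective ranking of the vertices yields a path-shaped tree. -/
theorem exists_chain [Finite V] [Nonempty V] (f : V → ℕ) (hf : Function.Injective f) :
    ∃ T : RootedTree V, ∀ x y, y ∈ T.subtree x ↔ f x ≤ f y := by
  have hpar : ∀ w, ∃ o : Option V, (o = none ∧ ∀ x, f w ≤ f x) ∨
      ∃ p, o = some p ∧ f p < f w ∧ ∀ x, f x < f w → f x ≤ f p := by
    intro w
    by_cases h : ∃ x, f x < f w
    · obtain ⟨p, hp, hmax⟩ := Set.exists_max_image {x | f x < f w} f (Set.toFinite _) h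
      exact ⟨some p, Or.inr ⟨p, rfl, hp, hmax⟩⟩
    · push Not at h
      exact ⟨none, Or.inl ⟨rfl, h⟩⟩
  choose par hpar using hpar
  have reach : ∀ n, ∀ x y, f y ≤ n → f x ≤ f y →
      Relation.ReflTransGen (fun a b => par a = some b) y x := by
    intro n
    induction n with
    | zero =>
      intro x y hy hxy
      obtain rfl : x = y := hf (by omega)
      exact Relation.ReflTransGen.refl
    | succ n ih =>
      intro x y hy hxy
      rcases hxy.eq_or_lt with h | h
      · obtain rfl := hf h
        exact Relation.ReflTransGen.refl
      · rcases hpar y with ⟨-, h'⟩ | ⟨p, hp, hlt, hmax⟩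
        · exact absurd (h' x) (by omega)
        · exact Relation.ReflTransGen.head hp (ih x p (by omega) (hmax x h))
  obtain ⟨r, -, hr⟩ := Set.exists_min_image Set.univ f Set.finite_univ Set.univ_nonempty
  refine ⟨⟨r, par, ?_, fun y => reach _ r y le_rfl (hr y trivial)⟩, fun x y =>
    ⟨fun h => ?_, reach _ x y le_rfl⟩⟩
  · rcases hpar r with ⟨h, -⟩ | ⟨p, -, hlt, -⟩
    · exact h
    · exact absurd (hr p trivial) (by omega)
  · induction h using Relation.ReflTransGen.head_induction_on with
    | refl => exact le_rfl
    | @head a p hap _ ih =>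
      rcases hpar a with ⟨h, -⟩ | ⟨p', h, hlt, -⟩
      · simp [h] at hap
      · obtain rfl : p' = p := Option.some.inj (h.symm.trans hap)
        omega

/-- The only child of `p` has everything after `p` as its subtree, so a later neighbour of `p`
suffices. -/
theorem isTight_of_chain {f : V → ℕ} (hT : ∀ x y, y ∈ T.subtree x ↔ f x ≤ f y)
    (h : ∀ p w, f p < f w → ∃ x, f p < f x ∧ G.Adj p x) : T.IsTight G := by
  refine ⟨fun x y _ => by simpa only [hT] using le_total _ _, fun p w hpw => ?_⟩
  have hlt : f p < f w := lt_of_not_ge fun hle => notMem_subtree_of_parent hpw ((hT _ _).2 hle)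
  obtain ⟨x, hx, hpx⟩ := h p w hlt
  refine ⟨x, ?_, hpx⟩
  rw [hT]
  by_contra hxw
  have hwx : w ∈ T.subtree x := (hT _ _).2 (by omega)
  have := (hT _ _).1 (parent_mem_subtree hwx (by rintro rfl; omega) hpw)
  omega

end RootedTree

/-! ### Search trees on `K_{2,q}` and the upper bound. -/

namespace CompleteBipartite

open GraphAssoc.RootedTree

variable {q : ℕ}

/-- The graph `K_{2,q}`. The two vertices `inl h` are called hubs, the vertices `inr i` items. -/
abbrev K (q : ℕ) : SimpleGraph (Fin 2 ⊕ Fin q) := completeBipartiteGraph (Fin 2) (Fin q)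

abbrev SearchTree (q : ℕ) := {T : RootedTree (Fin 2 ⊕ Fin q) // T.IsSearchTree (K q)}

variable {T T' F F' : SearchTree q} {u v : Fin 2 ⊕ Fin q} {h h' : Fin 2} {i j : Fin q}

theorem connectedOn_univ (hq : 0 < q) : ConnectedOn (K q) Set.univ := by
  have step : ∀ x y, (K q).Adj x y → Relation.ReflTransGen
      (fun a b => (K q).Adj a b ∧ a ∈ Set.univ ∧ b ∈ Set.univ) x y := fun x y h =>
    Relation.ReflTransGen.single ⟨h, trivial, trivial⟩
  rintro (h | i) - (h' | j) -
  · exact (step _ (Sum.inr ⟨0, hq⟩) (by simp)).trans (step _ _ (by simp))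
  · exact step _ _ (by simp)
  · exact step _ _ (by simp)
  · exact (step _ (Sum.inl 0) (by simp)).trans (step _ _ (by simp))

theorem isTight [NeZero q] (T : SearchTree q) : T.1.IsTight (K q) :=
  T.2.isTight (connectedOn_univ (NeZero.pos q))

theorem hub_total [NeZero q] (T : SearchTree q) (h : Fin 2) (i : Fin q) :
    Sum.inr i ∈ T.1.subtree (Sum.inl h) ∨ Sum.inl h ∈ T.1.subtree (Sum.inr i) :=
  (isTight T).comparable _ _ (by simp)

open Classical in
/-- The pairs `(h, i)` for which the hub `h` is an ancestor of the item `i`. -/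
noncomputable def above (T : SearchTree q) : Finset (Fin 2 × Fin q) :=
  {p | Sum.inr p.2 ∈ T.1.subtree (Sum.inl p.1)}

theorem mem_above : (h, i) ∈ above T ↔ Sum.inr i ∈ T.1.subtree (Sum.inl h) := by
  simp [above]

theorem notMem_above [NeZero q] :
    (h, i) ∉ above T ↔ Sum.inl h ∈ T.1.subtree (Sum.inr i) := by
  rw [mem_above]
  refine ⟨(hub_total T h i).resolve_left, fun h₁ h₂ => ?_⟩
  simpa using subtree_antisymm h₁ h₂

theorem mem_above_iff [NeZero q] (hr : IsRotation (K q) T.1 T'.1 u v)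
    (h₁ : ¬ (u = Sum.inl h ∧ v = Sum.inr i)) (h₂ : ¬ (u = Sum.inr i ∧ v = Sum.inl h)) :
    (h, i) ∈ above T ↔ (h, i) ∈ above T' := by
  rw [mem_above, mem_above]
  exact hr.mem_subtree_iff (by simp) h₁ h₂ (hub_total T h i) (hub_total T' h i)

theorem above_eq_of_item_item [NeZero q]
    (hr : IsRotation (K q) T.1 T'.1 (Sum.inr i) (Sum.inr j)) : above T = above T' := by
  ext ⟨h, k⟩
  exact mem_above_iff hr (by simp) (by simp)

theorem above_eq_of_hub_hub [NeZero q]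
    (hr : IsRotation (K q) T.1 T'.1 (Sum.inl h) (Sum.inl h')) : above T = above T' := by
  ext ⟨h, k⟩
  exact mem_above_iff hr (by simp) (by simp)

theorem above_eq_of_hub_item [NeZero q]
    (hr : IsRotation (K q) T.1 T'.1 (Sum.inl h) (Sum.inr i)) :
    (h, i) ∈ above T ∧ above T' = (above T).erase (h, i) := by
  have h₀ : (h, i) ∈ above T := mem_above.2 (mem_subtree_of_parent hr.child)
  refine ⟨h₀, ?_⟩
  ext ⟨k, j⟩
  by_cases hkj : (k, j) = (h, i)
  · have : (h, i) ∉ above T' := notMem_above.2 hr.fst_mem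
    simp only [hkj, this, Finset.mem_erase, ne_eq, not_true, false_and]
  · rw [Finset.mem_erase, ← mem_above_iff hr
      (by rintro ⟨h₁, h₂⟩; cases h₁; cases h₂; exact hkj rfl) (by simp)]
    simp [hkj]

theorem above_eq_of_item_hub [NeZero q]
    (hr : IsRotation (K q) T.1 T'.1 (Sum.inr i) (Sum.inl h)) :
    (h, i) ∉ above T ∧ above T' = insert (h, i) (above T) := by
  have h₀ : (h, i) ∉ above T := notMem_above.2 (mem_subtree_of_parent hr.child)
  refine ⟨h₀, ?_⟩
  ext ⟨k, j⟩
  by_cases hkj : (k, j) = (h, i)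
  · have : (h, i) ∈ above T' := mem_above.2 hr.fst_mem
    simp only [hkj, this, Finset.mem_insert, true_or]
  · rw [Finset.mem_insert, ← mem_above_iff hr (by simp)
      (by rintro ⟨h₁, h₂⟩; cases h₁; cases h₂; exact hkj rfl)]
    simp [hkj]

theorem adj_of_isRotation (hr : IsRotation (K q) T.1 T'.1 u v) :
    (rotationGraph (K q)).Adj T T' := by
  rw [rotationGraph, SimpleGraph.fromRel_adj]
  refine ⟨?_, Or.inl ⟨u, v, hr⟩⟩
  rintro rfl
  exact notMem_subtree_of_parent hr.child hr.fst_mem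

theorem exists_rotation [NeZero q] (hp : T.1.parent v = some u) :
    ∃ T' : SearchTree q, IsRotation (K q) T.1 T'.1 u v := by
  obtain ⟨T', hT'⟩ := exists_isRotation (K q) hp
  exact ⟨⟨T', (hT'.isTight (isTight T)).isSearchTree⟩, hT'⟩

theorem edist_le_of_isRotation {n : ℕ} (hr : IsRotation (K q) T.1 T'.1 u v)
    (hn : (rotationGraph (K q)).edist T' F ≤ n) :
    (rotationGraph (K q)).edist T F ≤ (n + 1 : ℕ) := by
  refine (SimpleGraph.edist_triangle (v := T')).trans ?_
  rw [SimpleGraph.edist_eq_one_iff_adj.2 (adj_of_isRotation hr), Nat.cast_add, add_comm]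
  exact add_le_add hn le_rfl

/-- The path from a hub down to an item contains an edge from a hub to an item. Rotating that edge
removes exactly one pair from `above`. -/
theorem exists_above_eq_empty [NeZero q] (n : ℕ) : ∀ T : SearchTree q, (above T).card = n →
    ∃ F : SearchTree q, above F = ∅ ∧ (rotationGraph (K q)).edist T F ≤ n := by
  induction n with
  | zero =>
    intro T hT
    exact ⟨T, Finset.card_eq_zero.1 hT, by simp⟩
  | succ n ih =>
    intro T hT
    obtain ⟨⟨h, i⟩, hhi⟩ : (above T).Nonempty := Finset.card_pos.1 (by omega)
    obtain ⟨c, p, hcp, hp, hc, -, -⟩ :=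
      exists_parent_step (fun x => x.isLeft = true) (mem_above.1 hhi) (by simp) (by simp)
    obtain ⟨h, rfl⟩ := Sum.isLeft_iff.1 hp
    obtain ⟨i, rfl⟩ := Sum.isRight_iff.1 (by simpa using hc)
    obtain ⟨T', hr⟩ := exists_rotation hcp
    obtain ⟨hmem, heq⟩ := above_eq_of_hub_item hr
    obtain ⟨F, hF, hd⟩ := ih T' (by rw [heq, Finset.card_erase_of_mem hmem]; omega)
    exact ⟨F, hF, edist_le_of_isRotation hr hd⟩

theorem exists_above_eq_univ [NeZero q] (n : ℕ) :
    ∀ T : SearchTree q, (above T).card + n = 2 * q →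
    ∃ F : SearchTree q, above F = Finset.univ ∧ (rotationGraph (K q)).edist T F ≤ n := by
  induction n with
  | zero =>
    intro T hT
    exact ⟨T, (Finset.card_eq_iff_eq_univ _).1 (by simpa using hT), by simp⟩
  | succ n ih =>
    intro T hT
    obtain ⟨⟨h, i⟩, hhi⟩ : ∃ p, p ∉ above T := by
      by_contra! hall
      have := (Finset.card_eq_iff_eq_univ (above T)).2 (Finset.eq_univ_iff_forall.2 hall)
      simp only [Fintype.card_prod, Fintype.card_fin] at this
      omega
    obtain ⟨c, p, hcp, hp, hc, -, -⟩ :=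
      exists_parent_step (fun x => x.isRight = true) (notMem_above.1 hhi) (by simp) (by simp)
    obtain ⟨i, rfl⟩ := Sum.isRight_iff.1 hp
    obtain ⟨h, rfl⟩ := Sum.isLeft_iff.1 (by simpa using hc)
    obtain ⟨T', hr⟩ := exists_rotation hcp
    obtain ⟨hmem, heq⟩ := above_eq_of_item_hub hr
    obtain ⟨F, hF, hd⟩ := ih T' (by rw [heq, Finset.card_insert_of_notMem hmem]; omega)
    exact ⟨F, hF, edist_le_of_isRotation hr hd⟩

/-- The hub `h` is below `i`. If `j` is below `h`, it is below `i`; otherwise `i` and `j` are both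
ancestors of `h`. -/
theorem item_total [NeZero q] (hi : (h, i) ∉ above T) (j : Fin q) :
    Sum.inr j ∈ T.1.subtree (Sum.inr i) ∨ Sum.inr i ∈ T.1.subtree (Sum.inr j) := by
  rw [notMem_above] at hi
  rcases hub_total T h j with hj | hj
  · exact Or.inl (mem_subtree_trans hj hi)
  · exact (subtree_total hi hj).symm

theorem exists_mem_above_of_hub_hub [NeZero q] (hne : h ≠ h')
    (hh : Sum.inl h' ∈ T.1.subtree (Sum.inl h)) : ∃ i, (h, i) ∈ above T := by
  obtain ⟨y, hy, -, hadj⟩ := (isTight T).exists_adj_of_ne hh (by simpa using hne.symm)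
  rcases y with k | i
  · simp at hadj
  · exact ⟨i, mem_above.2 hy⟩

theorem exists_notMem_above_of_item [NeZero q] {x : Fin 2 ⊕ Fin q} (hne : x ≠ Sum.inr i)
    (hx : x ∈ T.1.subtree (Sum.inr i)) : ∃ h, (h, i) ∉ above T := by
  obtain ⟨y, hy, -, hadj⟩ := (isTight T).exists_adj_of_ne hx hne
  rcases y with k | j
  · exact ⟨k, notMem_above.2 hy⟩
  · simp at hadj

open Classical in
/-- The pairs of items which have opposite orders in `F` and `F'`. -/
noncomputable def inversions (F F' : SearchTree q) : Finset (Fin q × Fin q) :=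
  {p | p.1 ≠ p.2 ∧ Sum.inr p.2 ∈ F.1.subtree (Sum.inr p.1) ∧
    Sum.inr p.1 ∈ F'.1.subtree (Sum.inr p.2)}

theorem mem_inversions : (i, j) ∈ inversions F F' ↔ i ≠ j ∧
    Sum.inr j ∈ F.1.subtree (Sum.inr i) ∧ Sum.inr i ∈ F'.1.subtree (Sum.inr j) := by
  simp [inversions]

theorem card_inversions_le (F F' : SearchTree q) : (inversions F F').card ≤ q.choose 2 := by
  classical
  have hdisj : Disjoint (inversions F F') ((inversions F F').map (Equiv.prodComm _ _).toEmbedding) := by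
    rw [Finset.disjoint_left]
    rintro ⟨i, j⟩ hij hji
    simp only [Finset.mem_map_equiv, Equiv.prodComm_symm, Equiv.prodComm_apply,
      Prod.swap_prod_mk, mem_inversions] at hij hji
    exact hij.1 (by simpa using subtree_antisymm hji.2.1 hij.2.1)
  have hsub : (inversions F F').disjUnion _ hdisj ⊆ Finset.univ.offDiag := by
    rintro ⟨i, j⟩ hij
    simp only [Finset.mem_disjUnion, Finset.mem_map_equiv, Equiv.prodComm_symm,
      Equiv.prodComm_apply, Prod.swap_prod_mk, mem_inversions] at hij
    rcases hij with hij | hij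
    · simpa using hij.1
    · simpa using hij.1.symm
  have := Finset.card_le_card hsub
  rw [Finset.card_disjUnion, Finset.card_map, Finset.offDiag_card, Finset.card_univ,
    Fintype.card_fin] at this
  rw [Nat.choose_two_right, Nat.le_div_iff_mul_le two_pos, Nat.mul_sub, mul_one]
  omega

theorem item_total_of_above_eq_empty [NeZero q] (hF : above F = ∅) (i j : Fin q) :
    Sum.inr j ∈ F.1.subtree (Sum.inr i) ∨ Sum.inr i ∈ F.1.subtree (Sum.inr j) :=
  item_total (h := 0) (by simp [hF]) j

/-- With no hub above an item, the items form a path with both hubs as leaves at its end, so the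
item order determines the tree. -/
theorem eq_of_inversions_eq_empty [NeZero q] (hF : above F = ∅) (hF' : above F' = ∅)
    (hinv : inversions F F' = ∅) : F = F' := by
  have hsubset : ∀ i j, Sum.inr j ∈ F.1.subtree (Sum.inr i) →
      Sum.inr j ∈ F'.1.subtree (Sum.inr i) := by
    intro i j hij
    by_cases hne : i = j
    · subst hne; exact F'.1.mem_subtree_self _
    refine (item_total_of_above_eq_empty hF' i j).resolve_right fun hji => ?_
    have : (i, j) ∈ inversions F F' := mem_inversions.2 ⟨hne, hij, hji⟩
    simp [hinv] at this
  refine Subtype.ext (eq_of_subtree_eq ?_)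
  have hhub : ∀ {F : SearchTree q}, above F = ∅ → ∀ k k' : Fin 2,
      (Sum.inl k' ∈ F.1.subtree (Sum.inl k) ↔ k = k') := by
    intro F hF k k'
    refine ⟨fun hk => ?_, fun hk => hk ▸ F.1.mem_subtree_self _⟩
    by_contra hne
    obtain ⟨i, hi⟩ := exists_mem_above_of_hub_hub hne hk
    simp [hF] at hi
  rintro (k | i) (k' | j)
  · rw [hhub hF, hhub hF']
  · rw [← mem_above, ← mem_above, hF, hF']
  · rw [← notMem_above, ← notMem_above, hF, hF']
  · refine ⟨hsubset i j, fun hij => ?_⟩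
    refine (item_total_of_above_eq_empty hF i j).elim id fun hji => ?_
    rw [subtree_antisymm hij (hsubset j i hji)]
    exact F.1.mem_subtree_self _

/-- Bubble sort: as long as inversions remain, one of them is a parent and its child, and rotating
it removes it without creating another. -/
theorem edist_le_card_inversions [NeZero q] (hF' : above F' = ∅) (n : ℕ) :
    ∀ F : SearchTree q, above F = ∅ → (inversions F F').card ≤ n →
      (rotationGraph (K q)).edist F F' ≤ n := by
  classical
  induction n with
  | zero =>
    intro F hF hn
    rw [eq_of_inversions_eq_empty hF hF' (Finset.card_eq_zero.1 (by omega))]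
    simp
  | succ n ih =>
    intro F hF hn
    by_cases hinv : inversions F F' = ∅
    · rw [eq_of_inversions_eq_empty hF hF' hinv]
      simp
    obtain ⟨⟨i, j⟩, hij⟩ := Finset.nonempty_iff_ne_empty.2 hinv
    obtain ⟨hne, h₁, h₂⟩ := mem_inversions.1 hij
    -- On the way from `i` down to `j` in `F`, the first exit from the `F'`-subtree of `i` is an
    -- inverted edge: were the child below its parent in `F'`, it would still be below `i`.
    obtain ⟨c, p, hcp, hp, hc, -, hjc⟩ :=
      exists_parent_step (fun x => x ∈ F'.1.subtree (Sum.inr i)) h₁ (F'.1.mem_subtree_self _)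
        (fun h => hne (by simpa using subtree_antisymm h₂ h))
    have hitem : ∀ x, Sum.inr j ∈ F.1.subtree x → ∃ k, x = Sum.inr k := by
      rintro (h | k) hx
      · have := mem_above.2 hx
        simp [hF] at this
      · exact ⟨k, rfl⟩
    obtain ⟨b, rfl⟩ := hitem c hjc
    obtain ⟨a, rfl⟩ := hitem p (mem_subtree_trans hjc (mem_subtree_of_parent hcp))
    have hab : Sum.inr a ∈ F'.1.subtree (Sum.inr b) :=
      (item_total_of_above_eq_empty hF' a b).resolve_left fun h => hc (mem_subtree_trans h hp)
    have hab' : a ≠ b := by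
      rintro rfl
      exact hc hp
    obtain ⟨F₁, hr⟩ := exists_rotation hcp
    have hF₁ : above F₁ = ∅ := by rw [← above_eq_of_item_item hr, hF]
    refine edist_le_of_isRotation hr (ih F₁ hF₁ ?_)
    have hsub : inversions F₁ F' ⊆ (inversions F F').erase (a, b) := by
      rintro ⟨k, l⟩ hkl
      obtain ⟨hkl', h₃, h₄⟩ := mem_inversions.1 hkl
      have hne₁ : (k, l) ≠ (a, b) := by
        rintro h
        cases h
        exact hab' (by simpa using subtree_antisymm hr.fst_mem h₃)
      have hne₂ : ¬ (a = l ∧ b = k) := by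
        rintro ⟨rfl, rfl⟩
        exact hab' (by simpa using subtree_antisymm hab h₄)
      refine Finset.mem_erase.2 ⟨hne₁, mem_inversions.2 ⟨hkl', ?_, h₄⟩⟩
      refine (hr.mem_subtree_iff (by simpa using hkl') ?_ (by simpa using hne₂)
        (item_total_of_above_eq_empty hF k l) (item_total_of_above_eq_empty hF₁ k l)).2 h₃
      rintro ⟨h₅, h₆⟩
      cases h₅; cases h₆
      exact hne₁ rfl
    have hmem : (a, b) ∈ inversions F F' :=
      mem_inversions.2 ⟨hab', mem_subtree_of_parent hcp, hab⟩
    have := Finset.card_le_card hsub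
    rw [Finset.card_erase_of_mem hmem] at this
    omega

/-- With both hubs above all items, the items are leaves and only the order of the hubs is free. -/
theorem eq_of_above_eq_univ [NeZero q] (hne : h ≠ h') (hF : above F = Finset.univ)
    (hF' : above F' = Finset.univ) (hh : Sum.inl h' ∈ F.1.subtree (Sum.inl h))
    (hh' : Sum.inl h' ∈ F'.1.subtree (Sum.inl h)) : F = F' := by
  have hitem : ∀ {F : SearchTree q}, above F = Finset.univ → ∀ i (x : Fin 2 ⊕ Fin q),
      (x ∈ F.1.subtree (Sum.inr i) ↔ x = Sum.inr i) := by
    intro F hF i x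
    refine ⟨fun hx => ?_, fun hx => hx ▸ F.1.mem_subtree_self _⟩
    by_contra hne
    obtain ⟨k, hk⟩ := exists_notMem_above_of_item hne hx
    simp [hF] at hk
  have hhub : ∀ {F : SearchTree q}, Sum.inl h' ∈ F.1.subtree (Sum.inl h) → ∀ k k' : Fin 2,
      (Sum.inl k' ∈ F.1.subtree (Sum.inl k) ↔ k = k' ∨ k = h ∧ k' = h') := by
    intro F hF k k'
    constructor
    · intro hk
      by_contra! hcon
      obtain ⟨rfl, rfl⟩ : k = h' ∧ k' = h := by
        have := hcon.1
        have := hcon.2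
        constructor <;> omega
      exact hne (by simpa using subtree_antisymm hk hF)
    · rintro (rfl | ⟨rfl, rfl⟩)
      · exact F.1.mem_subtree_self _
      · exact hF
  refine Subtype.ext (eq_of_subtree_eq ?_)
  rintro (k | i) x
  · rcases x with k' | j
    · rw [hhub hh, hhub hh']
    · rw [← mem_above, ← mem_above, hF, hF']
  · rw [hitem hF, hitem hF']

theorem edist_le_one_of_above_eq_univ [NeZero q] (hF : above F = Finset.univ)
    (hF' : above F' = Finset.univ) : (rotationGraph (K q)).edist F F' ≤ 1 := by
  have hub_hub : ∀ {F : SearchTree q}, above F = Finset.univ → ∀ h h' : Fin 2,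
      Sum.inl h' ∈ F.1.subtree (Sum.inl h) ∨ Sum.inl h ∈ F.1.subtree (Sum.inl h') := by
    intro F hF h h'
    have hmem : ∀ k, Sum.inr (0 : Fin q) ∈ F.1.subtree (Sum.inl k) := fun k =>
      mem_above.1 (by simp [hF])
    exact (subtree_total (hmem h) (hmem h')).symm
  have key : ∀ h h' : Fin 2, h ≠ h' → Sum.inl h' ∈ F.1.subtree (Sum.inl h) →
      (rotationGraph (K q)).edist F F' ≤ 1 := by
    intro h h' hne hh
    rcases hub_hub hF' h h' with hh' | hh'
    · rw [eq_of_above_eq_univ hne hF hF' hh hh']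
      simp
    · obtain ⟨c, hc, hhc⟩ := exists_child hh (by simpa using hne.symm)
      have hc' : c = Sum.inl h' := by
        rcases c with k | i
        · have hk : k ≠ h := by simpa using ne_of_parent hc
          congr 1
          omega
        · obtain ⟨k, hk⟩ := exists_notMem_above_of_item (by simp) hhc
          simp [hF] at hk
      subst hc'
      obtain ⟨F₁, hr⟩ := exists_rotation hc
      have hF₁ : above F₁ = Finset.univ := by rw [← above_eq_of_hub_hub hr, hF]
      rw [← eq_of_above_eq_univ hne.symm hF₁ hF' hr.fst_mem hh',
        SimpleGraph.edist_eq_one_iff_adj.2 (adj_of_isRotation hr)]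
  rcases hub_hub hF 0 1 with hh | hh
  · exact key 0 1 (by simp) hh
  · exact key 1 0 (by simp) hh

/-- The routes through `above = ∅` and through `above = univ` have bounds with sum `4 * q + q.choose
2 + 1`; the shorter one is taken. -/
theorem edist_le [NeZero q] (T T' : SearchTree q) :
    (rotationGraph (K q)).edist T T' ≤ ((4 * q + q.choose 2 + 1) / 2 : ℕ) := by
  have hcard : ∀ T : SearchTree q, (above T).card ≤ 2 * q := fun T => by
    simpa using Finset.card_le_univ (above T)
  obtain ⟨F, hF, hTF⟩ := exists_above_eq_empty _ T rfl
  obtain ⟨F', hF', hTF'⟩ := exists_above_eq_empty _ T' rfl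
  obtain ⟨O, hO, hTO⟩ := exists_above_eq_univ (2 * q - (above T).card) T
    (Nat.add_sub_cancel' (hcard T))
  obtain ⟨O', hO', hTO'⟩ := exists_above_eq_univ (2 * q - (above T').card) T'
    (Nat.add_sub_cancel' (hcard T'))
  rw [SimpleGraph.edist_comm] at hTF' hTO'
  have h₁ : (rotationGraph (K q)).edist T T' ≤
      ((above T).card + q.choose 2 + (above T').card : ℕ) := by
    push_cast
    refine (SimpleGraph.edist_triangle (v := F')).trans (add_le_add ?_ hTF')
    refine (SimpleGraph.edist_triangle (v := F)).trans (add_le_add hTF ?_)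
    exact edist_le_card_inversions hF' _ F hF (card_inversions_le F F')
  have h₂ : (rotationGraph (K q)).edist T T' ≤
      ((2 * q - (above T).card) + 1 + (2 * q - (above T').card) : ℕ) := by
    rw [Nat.cast_add, Nat.cast_add]
    refine (SimpleGraph.edist_triangle (v := O')).trans (add_le_add ?_ hTO')
    refine (SimpleGraph.edist_triangle (v := O)).trans (add_le_add hTO ?_)
    exact edist_le_one_of_above_eq_univ hO hO'
  have := hcard T
  have := hcard T'
  rcases le_or_gt ((above T).card + q.choose 2 + (above T').card)
    ((4 * q + q.choose 2 + 1) / 2) with h | h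
  · exact h₁.trans (by exact_mod_cast h)
  · exact h₂.trans (Nat.cast_le.2 (by omega))

end CompleteBipartite

/-! ### The lower bound: counting rotations along a walk. -/

namespace CompleteBipartite

open GraphAssoc.RootedTree

variable {q : ℕ} {T T' M M' : SearchTree q} {u v : Fin 2 ⊕ Fin q} {h h' : Fin 2} {i j : Fin q}

/-- The number of hubs among the ancestors of the item `i`. -/
noncomputable def depth (T : SearchTree q) (i : Fin q) : ℕ :=
  (if (0, i) ∈ above T then 1 else 0) + (if (1, i) ∈ above T then 1 else 0)

theorem depth_le_two (T : SearchTree q) (i : Fin q) : depth T i ≤ 2 := by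
  unfold depth
  split_ifs <;> simp

theorem exists_notMem_of_depth_ne_two (hi : depth T i ≠ 2) : ∃ h, (h, i) ∉ above T := by
  by_contra! hall
  exact hi (by simp [depth, hall])

theorem item_total_of_depth [NeZero q] (hij : ¬ (depth T i = 2 ∧ depth T j = 2)) :
    Sum.inr j ∈ T.1.subtree (Sum.inr i) ∨ Sum.inr i ∈ T.1.subtree (Sum.inr j) := by
  by_cases hi : depth T i = 2
  · obtain ⟨h, hj⟩ := exists_notMem_of_depth_ne_two (fun hj => hij ⟨hi, hj⟩)
    exact (item_total hj i).symm
  · obtain ⟨h, hi⟩ := exists_notMem_of_depth_ne_two hi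
    exact item_total hi j

theorem depth_eq_of_above_eq (h : above T = above T') (i : Fin q) : depth T i = depth T' i := by
  simp [depth, h]

theorem depth_insert (heq : above T' = insert (h, i) (above T)) :
    (∀ j, j ≠ i → depth T j = depth T' j) ∧ depth T i ≤ depth T' i ∧
      depth T' i ≤ depth T i + 1 := by
  refine ⟨fun j hj => by simp [depth, heq, hj], ?_⟩
  simp only [depth, heq, Finset.mem_insert, Prod.mk.injEq, and_true]
  obtain rfl | rfl : h = 0 ∨ h = 1 := by omega
  all_goals simp; split_ifs <;> simp

/-- `i` and `j` have the same order in `M` and `M'`, unless they hang below both hubs in `M` or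
in `M'`. -/
def SameOrder (M M' : SearchTree q) (i j : Fin q) : Prop :=
  ¬ (depth M i = 2 ∧ depth M j = 2) → ¬ (depth M' i = 2 ∧ depth M' j = 2) →
    (Sum.inr j ∈ M.1.subtree (Sum.inr i) ↔ Sum.inr j ∈ M'.1.subtree (Sum.inr i))

theorem sameOrder_of_isRotation [NeZero q] (hr : IsRotation (K q) M.1 M'.1 u v) (hne : i ≠ j)
    (h₁ : ¬ (u = Sum.inr i ∧ v = Sum.inr j)) (h₂ : ¬ (u = Sum.inr j ∧ v = Sum.inr i)) :
    SameOrder M M' i j := fun h h' =>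
  hr.mem_subtree_iff (by simpa using hne) h₁ h₂ (item_total_of_depth h) (item_total_of_depth h')

/-- The effect of a rotation on depths and orders: either at most the depth of one item `i`
changes, and that by at most one, or at most the order of one pair of items. -/
def Step (M M' : SearchTree q) : Prop :=
  (∃ i, (∀ j, j ≠ i → depth M j = depth M' j) ∧
      depth M i ≤ depth M' i + 1 ∧ depth M' i ≤ depth M i + 1 ∧
      ∀ k l, k ≠ l → SameOrder M M' k l) ∨
  ∃ i j, (∀ k, depth M k = depth M' k) ∧
    ∀ k l, k ≠ l → (k, l) ≠ (i, j) → (k, l) ≠ (j, i) → SameOrder M M' k l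

theorem Step.symm (hs : Step M M') : Step M' M := by
  rcases hs with ⟨i, h₁, h₂, h₃, h₄⟩ | ⟨i, j, h₁, h₂⟩
  · exact Or.inl ⟨i, fun j hj => (h₁ j hj).symm, h₃, h₂,
      fun k l hkl a b => (h₄ k l hkl b a).symm⟩
  · exact Or.inr ⟨i, j, fun k => (h₁ k).symm, fun k l hkl a b c d => (h₂ k l hkl a b d c).symm⟩

theorem step_of_isRotation [NeZero q] (hr : IsRotation (K q) M.1 M'.1 u v) : Step M M' := by
  rcases u with h | i <;> rcases v with h' | j
  · have := depth_eq_of_above_eq (above_eq_of_hub_hub hr)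
    -- No depth changes here; item `0` is a dummy.
    refine Or.inl ⟨0, fun j _ => this j, by simp [this], by simp [this], fun k l hkl => ?_⟩
    exact sameOrder_of_isRotation hr hkl (by simp) (by simp)
  · obtain ⟨hmem, heq⟩ := above_eq_of_hub_item hr
    obtain ⟨h₁, h₂, h₃⟩ := depth_insert (T := M') (T' := M) (h := h) (i := j)
      (by rw [heq, Finset.insert_erase hmem])
    refine Or.inl ⟨j, fun k hk => (h₁ k hk).symm, h₃, by omega, fun k l hkl => ?_⟩
    exact sameOrder_of_isRotation hr hkl (by simp) (by simp)
  · obtain ⟨h₁, h₂, h₃⟩ := depth_insert (above_eq_of_item_hub hr).2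
    refine Or.inl ⟨i, h₁, by omega, h₃, fun k l hkl => ?_⟩
    exact sameOrder_of_isRotation hr hkl (by simp) (by simp)
  · refine Or.inr ⟨i, j, depth_eq_of_above_eq (above_eq_of_item_item hr), fun k l hkl h₁ h₂ => ?_⟩
    refine sameOrder_of_isRotation hr hkl ?_ ?_
    · rintro ⟨h₃, h₄⟩
      cases h₃; cases h₄
      exact h₁ rfl
    · rintro ⟨h₃, h₄⟩
      cases h₃; cases h₄
      exact h₂ rfl

theorem isRotation_of_adj (ha : (rotationGraph (K q)).Adj M M') :
    (∃ u v, IsRotation (K q) M.1 M'.1 u v) ∨ ∃ u v, IsRotation (K q) M'.1 M.1 u v := by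
  rw [rotationGraph, SimpleGraph.fromRel_adj] at ha
  exact ha.2

theorem step_of_adj [NeZero q] (ha : (rotationGraph (K q)).Adj M M') : Step M M' := by
  rcases isRotation_of_adj ha with ⟨u, v, hr⟩ | ⟨u, v, hr⟩
  · exact step_of_isRotation hr
  · exact (step_of_isRotation hr).symm

/-- The number of rotations of `i` with a hub on a walk between `T` and `M`, bounded from below;
`X` is the set of the items which hang below both hubs at some time. -/
noncomputable def hubCost (T M : SearchTree q) (X : Finset (Fin q)) (i : Fin q) : ℕ :=
  if i ∈ X then (2 - depth T i) + (2 - depth M i)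
  else (depth T i - depth M i) + (depth M i - depth T i)

/-- The inversions which are not inside `X`. -/
noncomputable def inversionsOff (T M : SearchTree q) (X : Finset (Fin q)) :
    Finset (Fin q × Fin q) :=
  (inversions T M).filter fun p => ¬ (p.1 ∈ X ∧ p.2 ∈ X)

theorem mem_inversionsOff {X : Finset (Fin q)} : (i, j) ∈ inversionsOff T M X ↔
    (i ≠ j ∧ Sum.inr j ∈ T.1.subtree (Sum.inr i) ∧ Sum.inr i ∈ M.1.subtree (Sum.inr j)) ∧
      ¬ (i ∈ X ∧ j ∈ X) := by
  rw [inversionsOff, Finset.mem_filter, mem_inversions]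

/-- Depths change by at most one, one item per rotation, so an item that visits depth 2 climbs there
and back. An inversion not inside `X` needs its own rotation, since its two items never have depth 2
together. As `T` has no item of depth 2, the induction starts with `X = ∅`. -/
theorem exists_cost_le_length [NeZero q] (hT : ∀ i, depth T i ≤ 1)
    (p : (rotationGraph (K q)).Walk M T) :
    ∃ X : Finset (Fin q), (∀ i, depth M i = 2 → i ∈ X) ∧
      ∑ i, hubCost T M X i + (inversionsOff T M X).card ≤ p.length := by
  induction p with
  | nil =>
    refine ⟨∅, fun i hi => by have := hT i; omega, ?_⟩
    rename_i M
    have : inversionsOff M M ∅ = ∅ := by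
      ext ⟨i, j⟩
      simp only [mem_inversionsOff, Finset.notMem_empty, iff_false]
      rintro ⟨⟨h₁, h₂, h₃⟩, -⟩
      exact h₁ (by simpa using subtree_antisymm h₃ h₂)
    simp [this, hubCost]
  | @cons M M₁ T ha p ih =>
    obtain ⟨X, hX, hle⟩ := ih hT
    rw [SimpleGraph.Walk.length_cons]
    rcases step_of_adj ha with ⟨i, hdepth, h₁, h₂, hord⟩ | ⟨i, j, hdepth, hord⟩
    · refine ⟨if depth M i = 2 then insert i X else X, fun j hj => ?_, ?_⟩
      · by_cases hji : j = i
        · subst hji; simp [hj]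
        · have := hX j (by rw [← hdepth j hji, hj])
          split_ifs <;> simp [this]
      have hcost : ∑ j, hubCost T M (if depth M i = 2 then insert i X else X) j ≤
          ∑ j, (hubCost T M₁ X j + if j = i then 1 else 0) := by
        refine Finset.sum_le_sum fun j _ => ?_
        by_cases hji : j = i
        · subst hji
          have h₃ := hT j
          have h₄ := hX j
          have h₅ := depth_le_two M j
          have h₆ := depth_le_two M₁ j
          by_cases hj : depth M j = 2
          · simp only [hubCost, hj, if_true, Finset.mem_insert_self]
            split_ifs with hjX
            · omega
            · have : depth M₁ j ≠ 2 := fun h => hjX (h₄ h)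
              omega
          · simp only [hubCost, hj, if_false, if_true]
            split_ifs <;> omega
        · have : (j ∈ if depth M i = 2 then insert i X else X) ↔ j ∈ X := by
            split_ifs <;> simp [hji]
          simp [hubCost, this, hji, hdepth j hji]
      -- A pair whose order is not preserved has depth 2 in `M` or `M₁`, hence lies inside the
      -- enlarged set and is not counted.
      have hinv : inversionsOff T M (if depth M i = 2 then insert i X else X) ⊆
          inversionsOff T M₁ X := by
        rintro ⟨k, l⟩ hkl
        obtain ⟨⟨hne, h₃, h₄⟩, h₅⟩ := mem_inversionsOff.1 hkl
        have h₆ : ¬ (k ∈ X ∧ l ∈ X) := by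
          rintro ⟨hk, hl⟩
          refine h₅ ?_
          split_ifs <;> simp [hk, hl]
        refine mem_inversionsOff.2 ⟨⟨hne, h₃, (hord l k hne.symm ?_ ?_).1 h₄⟩, h₆⟩
        · rintro ⟨hl, hk⟩
          apply h₅
          have hmem : ∀ j, depth M j = 2 → j ∈ if depth M i = 2 then insert i X else X := by
            intro j hj
            by_cases hji : j = i
            · subst hji; simp [hj]
            · have := hX j (by rw [← hdepth j hji, hj])
              split_ifs <;> simp [this]
          exact ⟨hmem k hk, hmem l hl⟩
        · exact fun h => h₆ ⟨hX k h.2, hX l h.1⟩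
      have := Finset.card_le_card hinv
      rw [Finset.sum_add_distrib, Finset.sum_ite_eq' Finset.univ i, if_pos (Finset.mem_univ i)]
        at hcost
      omega
    · refine ⟨X, fun k hk => hX k (by rw [← hdepth, hk]), ?_⟩
      have hcost : ∀ k, hubCost T M X k = hubCost T M₁ X k := fun k => by
        simp [hubCost, hdepth k]
      -- Only the pair of `i` and `j` can be new, and the order in `T` leaves just one of its two
      -- orientations as a possible inversion.
      obtain ⟨e, he⟩ : ∃ e, inversionsOff T M X ⊆ insert e (inversionsOff T M₁ X) := by
        have key : ∀ k l, (k, l) ∈ inversionsOff T M X → (k, l) ≠ (i, j) → (k, l) ≠ (j, i) →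
            (k, l) ∈ inversionsOff T M₁ X := by
          intro k l hkl h₁ h₂
          obtain ⟨⟨hne, h₃, h₄⟩, h₅⟩ := mem_inversionsOff.1 hkl
          have h₆ : ¬ (depth M₁ l = 2 ∧ depth M₁ k = 2) := fun h => h₅ ⟨hX k h.2, hX l h.1⟩
          refine mem_inversionsOff.2 ⟨⟨hne, h₃, (hord l k hne.symm ?_ ?_ ?_ h₆).1 h₄⟩, h₅⟩
          · rintro h; cases h; exact h₂ rfl
          · rintro h; cases h; exact h₁ rfl
          · rwa [hdepth, hdepth]
        by_cases hij : Sum.inr j ∈ T.1.subtree (Sum.inr i)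
        · refine ⟨(i, j), ?_⟩
          rintro ⟨k, l⟩ hkl
          by_cases h₁ : (k, l) = (i, j)
          · exact Finset.mem_insert.2 (Or.inl h₁)
          refine Finset.mem_insert_of_mem (key k l hkl h₁ ?_)
          rintro h
          cases h
          obtain ⟨⟨hne, h₃, -⟩, -⟩ := mem_inversionsOff.1 hkl
          exact hne (by simpa using subtree_antisymm hij h₃)
        · refine ⟨(j, i), ?_⟩
          rintro ⟨k, l⟩ hkl
          by_cases h₁ : (k, l) = (j, i)
          · exact Finset.mem_insert.2 (Or.inl h₁)
          refine Finset.mem_insert_of_mem (key k l hkl ?_ h₁)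
          rintro h
          cases h
          exact hij (mem_inversionsOff.1 hkl).1.2.1
      have := (Finset.card_le_card he).trans (Finset.card_insert_le _ _)
      have hsum : ∑ k, hubCost T M X k = ∑ k, hubCost T M₁ X k :=
        Finset.sum_congr rfl fun k _ => hcost k
      omega

/-- No item can lie between a hub and its parent hub, so every item is below both or below neither.
-/
theorem depth_of_hub_rotation [NeZero q] (hne : h ≠ h')
    (hr : IsRotation (K q) M.1 M'.1 (Sum.inl h) (Sum.inl h')) (i : Fin q) : depth M i ≠ 1 := by
  have hsub := mem_subtree_of_parent hr.child
  have hiff : (h, i) ∈ above M ↔ (h', i) ∈ above M := by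
    constructor
    · intro hi
      by_contra hi'
      have := parent_mem_subtree (notMem_above.1 hi') (by simp) hr.child
      exact notMem_above.2 this hi
    · exact fun hi => mem_above.2 (mem_subtree_trans (mem_above.1 hi) hsub)
  have : (0, i) ∈ above M ↔ (1, i) ∈ above M := by
    obtain ⟨rfl, rfl⟩ | ⟨rfl, rfl⟩ : h = 0 ∧ h' = 1 ∨ h = 1 ∧ h' = 0 := by omega
    · exact hiff
    · exact hiff.symm
  simp only [depth, this]
  split_ifs <;> simp

/-- An item below both hubs, or below one hub and above the other, would make the hubs comparable.
-/
theorem depth_eq_zero_of_hubs [NeZero q] (h₁ : Sum.inl 1 ∉ M.1.subtree (Sum.inl 0))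
    (h₂ : Sum.inl 0 ∉ M.1.subtree (Sum.inl 1)) (i : Fin q) : depth M i = 0 := by
  have h₃ : ¬ ((0, i) ∈ above M ∧ (1, i) ∈ above M) := by
    rintro ⟨h₃, h₄⟩
    rcases subtree_total (mem_above.1 h₃) (mem_above.1 h₄) with h | h
    · exact h₂ h
    · exact h₁ h
  have h₄ : (0, i) ∉ above M := fun h₄ =>
    h₁ (mem_subtree_trans (notMem_above.1 fun h => h₃ ⟨h₄, h⟩) (mem_above.1 h₄))
  have h₅ : (1, i) ∉ above M := fun h₅ =>
    h₂ (mem_subtree_trans (notMem_above.1 fun h => h₃ ⟨h, h₅⟩) (mem_above.1 h₅))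
  simp [depth, h₄, h₅]

/-- A walk which reverses the order of the hubs passes through a tree in which they are not
comparable, or through a rotation of the two hubs. -/
theorem exists_split [NeZero q] (p : (rotationGraph (K q)).Walk T T')
    (hT : Sum.inl 1 ∈ T.1.subtree (Sum.inl 0)) (hT' : Sum.inl 1 ∉ T'.1.subtree (Sum.inl 0)) :
    ∃ (M M' : SearchTree q) (p₁ : (rotationGraph (K q)).Walk T M)
      (p₂ : (rotationGraph (K q)).Walk M' T'), (∀ i, depth M i = depth M' i) ∧
      (∀ i j, i ≠ j → SameOrder M M' i j) ∧
      ((∀ i, depth M i = 0) ∧ p₁.length + p₂.length ≤ p.length ∨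
        (∀ i, depth M i ≠ 1) ∧ p₁.length + p₂.length + 1 ≤ p.length) := by
  induction p with
  | nil => exact absurd hT hT'
  | @cons T M T' ha p ih =>
    by_cases h₁ : Sum.inl 1 ∈ M.1.subtree (Sum.inl 0)
    · obtain ⟨N, N', p₁, p₂, h₂, h₃, h₄⟩ := ih h₁ hT'
      refine ⟨N, N', SimpleGraph.Walk.cons ha p₁, p₂, h₂, h₃, ?_⟩
      rw [SimpleGraph.Walk.length_cons, SimpleGraph.Walk.length_cons]
      rcases h₄ with ⟨h₄, h₅⟩ | ⟨h₄, h₅⟩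
      · exact Or.inl ⟨h₄, by omega⟩
      · exact Or.inr ⟨h₄, by omega⟩
    by_cases h₂ : Sum.inl 0 ∈ M.1.subtree (Sum.inl 1)
    -- The hubs are reversed by this very step, so it is their rotation. It belongs to neither half,
    -- whence the extra one in the length.
    · refine ⟨T, M, SimpleGraph.Walk.nil, p, ?_⟩
      rw [SimpleGraph.Walk.length_cons, SimpleGraph.Walk.length_nil]
      rcases isRotation_of_adj ha with ⟨u, v, hr⟩ | ⟨u, v, hr⟩
      · obtain ⟨rfl, rfl⟩ := hr.eq_of_reversed (by simp) hT h₂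
        exact ⟨depth_eq_of_above_eq (above_eq_of_hub_hub hr), fun i j hij =>
          sameOrder_of_isRotation hr hij (by simp) (by simp),
          Or.inr ⟨depth_of_hub_rotation (by simp) hr, by omega⟩⟩
      · obtain ⟨rfl, rfl⟩ := hr.eq_of_reversed (by simp) h₂ hT
        have hd := depth_eq_of_above_eq (above_eq_of_hub_hub hr)
        refine ⟨fun i => (hd i).symm, fun i j hij a b => (sameOrder_of_isRotation hr hij (by simp)
          (by simp) b a).symm, Or.inr ⟨fun i => ?_, by omega⟩⟩
        rw [← hd]
        exact depth_of_hub_rotation (by simp) hr i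
    · refine ⟨M, M, SimpleGraph.Walk.cons ha SimpleGraph.Walk.nil, p, fun _ => rfl,
        fun _ _ _ _ _ => Iff.rfl, Or.inl ⟨depth_eq_zero_of_hubs h₁ h₂, ?_⟩⟩
      simp [add_comm]

/-- The increasing pairs in `X`. -/
def increasingPairs (X : Finset (Fin q)) : Finset (Fin q × Fin q) :=
  (X ×ˢ X).filter fun p => p.1 < p.2

theorem mem_increasingPairs {X : Finset (Fin q)} :
    (i, j) ∈ increasingPairs X ↔ (i ∈ X ∧ j ∈ X) ∧ i < j := by
  simp [increasingPairs]

theorem card_increasingPairs (X : Finset (Fin q)) :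
    (increasingPairs X).card = X.card.choose 2 := by
  have hdisj : Disjoint (increasingPairs X)
      ((increasingPairs X).map (Equiv.prodComm _ _).toEmbedding) := by
    rw [Finset.disjoint_left]
    rintro ⟨i, j⟩ hij hji
    simp only [Finset.mem_map_equiv, Equiv.prodComm_symm, Equiv.prodComm_apply,
      Prod.swap_prod_mk, mem_increasingPairs] at hij hji
    exact lt_asymm hij.2 hji.2
  have heq : (increasingPairs X).disjUnion _ hdisj = X.offDiag := by
    ext ⟨i, j⟩
    simp only [Finset.mem_disjUnion, Finset.mem_map_equiv, Equiv.prodComm_symm,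
      Equiv.prodComm_apply, Prod.swap_prod_mk, mem_increasingPairs, Finset.mem_offDiag]
    have := lt_or_lt_iff_ne (a := i) (b := j)
    tauto
  have := congrArg Finset.card heq
  rw [Finset.card_disjUnion, Finset.card_map, Finset.offDiag_card] at this
  rw [Nat.choose_two_right, Nat.mul_sub, mul_one]
  omega

/-- The three conditions say that sinking a set `X` of items below both hubs saves no more than it
costs: it saves at most `X.card.choose 2` item rotations. `hcond` and `hcond'` serve the two halves
when the hubs become incomparable. `hcond₂` serves the union of both sets when the hubs are rotated;
its `+ 1` is that rotation. -/
theorem length_ge [NeZero q] (hT : ∀ i, depth T i ≤ 1) (hT' : ∀ i, depth T' i ≤ 1)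
    (hhub : Sum.inl 1 ∈ T.1.subtree (Sum.inl 0)) (hhub' : Sum.inl 1 ∉ T'.1.subtree (Sum.inl 0))
    (hord : ∀ i j, i < j → Sum.inr j ∈ T.1.subtree (Sum.inr i))
    (hord' : ∀ i j, i < j → Sum.inr i ∈ T'.1.subtree (Sum.inr j))
    (hcond : ∀ X : Finset (Fin q), X.card.choose 2 + 2 * ∑ i ∈ X, depth T i ≤ 4 * X.card)
    (hcond' : ∀ X : Finset (Fin q), X.card.choose 2 + 2 * ∑ i ∈ X, depth T' i ≤ 4 * X.card)
    (hcond₂ : ∀ X : Finset (Fin q),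
      X.card.choose 2 + 2 * ∑ i ∈ X, (depth T i + depth T' i) ≤ 4 * X.card + 1)
    (p : (rotationGraph (K q)).Walk T T') :
    ∑ i, (depth T i + depth T' i) + q.choose 2 ≤ p.length := by
  obtain ⟨M, M', p₁, p₂, hdepth, hsame, hM⟩ := exists_split p hhub hhub'
  obtain ⟨X, hX, hle⟩ := exists_cost_le_length hT p₁.reverse
  obtain ⟨X', hX', hle'⟩ := exists_cost_le_length hT' p₂
  rw [SimpleGraph.Walk.length_reverse] at hle
  -- The orders in `T` and `T'` are opposite, so a pair comparable at the cut is inverted in one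
  -- half.
  have hcover : ∀ i j, i < j → (i ∈ X ∧ j ∈ X) ∨ (i ∈ X' ∧ j ∈ X') ∨
      (i, j) ∈ inversionsOff T M X ∨ (j, i) ∈ inversionsOff T' M' X' := by
    intro i j hij
    by_cases h₁ : i ∈ X ∧ j ∈ X
    · exact Or.inl h₁
    by_cases h₂ : i ∈ X' ∧ j ∈ X'
    · exact Or.inr (Or.inl h₂)
    have h₃ : ¬ (depth M i = 2 ∧ depth M j = 2) := fun h => h₁ ⟨hX i h.1, hX j h.2⟩
    have h₄ : ¬ (depth M' i = 2 ∧ depth M' j = 2) := fun h => h₂ ⟨hX' i h.1, hX' j h.2⟩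
    rcases item_total_of_depth h₃ with h₅ | h₅
    · refine Or.inr (Or.inr (Or.inr (mem_inversionsOff.2 ⟨⟨hij.ne', hord' i j hij, ?_⟩, ?_⟩)))
      · exact (hsame i j hij.ne h₃ h₄).1 h₅
      · exact fun h => h₂ h.symm
    · exact Or.inr (Or.inr (Or.inl (mem_inversionsOff.2 ⟨⟨hij.ne, hord i j hij, h₅⟩, h₁⟩)))
  have hcard : ∀ S : Finset (Fin q × Fin q),
      (∀ i j, i < j → (i ∈ X ∧ j ∈ X) ∨ (i ∈ X' ∧ j ∈ X') → (i, j) ∈ S) →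
      q.choose 2 ≤ S.card + (inversionsOff T M X).card + (inversionsOff T' M' X').card := by
    intro S hS
    have hsub : increasingPairs Finset.univ ⊆ (S ∪ inversionsOff T M X) ∪
        (inversionsOff T' M' X').map (Equiv.prodComm _ _).toEmbedding := by
      rintro ⟨i, j⟩ hij
      have hij := (mem_increasingPairs.1 hij).2
      have := hS i j hij
      simp only [Finset.mem_union, Finset.mem_map_equiv, Equiv.prodComm_symm,
        Equiv.prodComm_apply, Prod.swap_prod_mk]
      rcases hcover i j hij with h | h | h | h <;> tauto
    have h₁ := (Finset.card_le_card hsub).trans (Finset.card_union_le _ _)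
    have h₂ := Finset.card_union_le S (inversionsOff T M X)
    rw [card_increasingPairs, Finset.card_univ, Fintype.card_fin, Finset.card_map] at h₁
    omega
  rcases hM with ⟨hM, hlen⟩ | ⟨hM, hlen⟩
  -- An item of depth `d` in `T` costs `(2 - d) + 2 = d + (4 - 2 * d)` if it is in `X`, and `d`
  -- otherwise.
  · have hcost : ∀ {T M : SearchTree q} (X : Finset (Fin q)), (∀ i, depth T i ≤ 1) →
        (∀ i, depth M i = 0) →
        ∑ i, hubCost T M X i + 2 * ∑ i ∈ X, depth T i = ∑ i, depth T i + 4 * X.card := by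
      intro T M X hT hM
      have h₁ : ∑ i ∈ X, depth T i = ∑ i, if i ∈ X then depth T i else 0 := by simp
      have h₂ : X.card = ∑ i, if i ∈ X then 1 else 0 := by simp
      rw [h₁, h₂, Finset.mul_sum, Finset.mul_sum, ← Finset.sum_add_distrib,
        ← Finset.sum_add_distrib]
      refine Finset.sum_congr rfl fun i _ => ?_
      have := hT i
      simp only [hubCost, hM i]
      split_ifs <;> omega
    have h₁ := hcost X hT hM
    have h₂ := hcost X' hT' (fun i => (hdepth i).symm.trans (hM i))
    have h₃ := hcond X
    have h₄ := hcond' X'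
    have h₅ := hcard (increasingPairs X ∪ increasingPairs X') (fun i j hij h => by
      rw [Finset.mem_union, mem_increasingPairs, mem_increasingPairs]
      tauto)
    have h₆ := Finset.card_union_le (increasingPairs X) (increasingPairs X')
    rw [card_increasingPairs, card_increasingPairs] at h₆
    rw [Finset.sum_add_distrib]
    omega
  -- At the cut each depth is 0 or 2. With depths `d` and `d'` at the ends, an item costs at least
  -- `4 - d - d'` if it is in `X ∪ X'`. Otherwise it has depth 0 at the cut and costs `d + d'`.
  · have hcost : ∑ i, (depth T i + depth T' i) + 4 * (X ∪ X').card ≤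
        ∑ i, hubCost T M X i + ∑ i, hubCost T' M' X' i +
          2 * ∑ i ∈ X ∪ X', (depth T i + depth T' i) := by
      have h₁ : ∑ i ∈ X ∪ X', (depth T i + depth T' i) =
          ∑ i, if i ∈ X ∪ X' then depth T i + depth T' i else 0 := by
        rw [Finset.sum_ite_mem, Finset.univ_inter]
      have h₂ : (X ∪ X').card = ∑ i, if i ∈ X ∪ X' then 1 else 0 := by
        rw [Finset.sum_ite_mem, Finset.univ_inter, Finset.card_eq_sum_ones]
      rw [h₁, h₂, Finset.mul_sum, Finset.mul_sum, ← Finset.sum_add_distrib,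
        ← Finset.sum_add_distrib, ← Finset.sum_add_distrib]
      refine Finset.sum_le_sum fun i _ => ?_
      have h₃ := hT i
      have h₄ := hT' i
      have h₅ := hM i
      have h₆ := depth_le_two M i
      have h₇ := hX i
      have h₈ := hX' i
      rw [← hdepth] at h₈
      simp only [hubCost, ← hdepth, Finset.mem_union]
      by_cases hi : i ∈ X <;> by_cases hi' : i ∈ X' <;>
        simp only [hi, hi', or_true, or_false, if_true, if_false, imp_false] at h₇ h₈ ⊢ <;> omega
    have h₃ := hcond₂ (X ∪ X')
    have h₅ := hcard (increasingPairs (X ∪ X')) (fun i j hij h => by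
      rw [mem_increasingPairs, Finset.mem_union, Finset.mem_union]
      tauto)
    rw [card_increasingPairs] at h₅
    omega

/-! ### A pair of trees at maximal distance. -/

/-- The rank function of the path-shaped tree `0, …, k - 1, a, k, …, q - 1, b`. -/
def rank (k : Fin q) : Fin 2 ⊕ Fin q → ℕ
  -- Items have even ranks and hubs odd ones, so a hub fits between consecutive items.
  | Sum.inl h => if h = 0 then 2 * k + 1 else 2 * q + 3
  | Sum.inr i => 2 * i + 2

/-- The rank function of the path-shaped tree `q - 1, …, l, b, l - 1, …, 0, a`. -/
def rank' (l : ℕ) : Fin 2 ⊕ Fin q → ℕ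
  | Sum.inl h => if h = 0 then 2 * q + 1 else 2 * (q - l) + 1
  | Sum.inr i => 2 * (q - i)

theorem exists_searchTree [NeZero q] {f : Fin 2 ⊕ Fin q → ℕ} (hf : Function.Injective f)
    (h : ∀ p w, f p < f w → ∃ x, f p < f x ∧ (K q).Adj p x) :
    ∃ T : SearchTree q, ∀ x y, y ∈ T.1.subtree x ↔ f x ≤ f y := by
  obtain ⟨T, hT⟩ := exists_chain f hf
  exact ⟨⟨T, (isTight_of_chain hT h).isSearchTree⟩, hT⟩

theorem exists_tree_rank [NeZero q] (k : Fin q) :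
    ∃ T : SearchTree q, ∀ x y, y ∈ T.1.subtree x ↔ rank k x ≤ rank k y := by
  have hk := k.2
  refine exists_searchTree ?_ ?_
  · rintro (h | i) (h' | j) hij <;> simp only [rank] at hij
    · congr 1
      split_ifs at hij <;> omega
    · split_ifs at hij <;> omega
    · split_ifs at hij <;> omega
    · congr 1
      omega
  · rintro (h | i) w hw
    -- The last item is below hub `0` because `k < q`; hub `1` ends the path, so nothing is required
    -- of it.
    · refine ⟨Sum.inr ⟨q - 1, by omega⟩, ?_, by simp⟩
      obtain rfl | rfl : h = 0 ∨ h = 1 := by omega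
      · simp [rank]; omega
      · rcases w with h' | j
        · simp only [rank] at hw
          split_ifs at hw <;> simp_all
          omega
        · simp [rank] at hw; omega
    · exact ⟨Sum.inl 1, by simp [rank], by simp⟩

theorem exists_tree_rank' [NeZero q] {l : ℕ} (hl : 0 < l) (hlq : l ≤ q) :
    ∃ T : SearchTree q, ∀ x y, y ∈ T.1.subtree x ↔ rank' l x ≤ rank' l y := by
  refine exists_searchTree ?_ ?_
  · rintro (h | i) (h' | j) hij <;> simp only [rank'] at hij
    · congr 1
      split_ifs at hij <;> omega
    · split_ifs at hij <;> omega
    · split_ifs at hij <;> omega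
    · congr 1
      omega
  · rintro (h | i) w hw
    -- Item `0` is below hub `1` because `0 < l`; hub `0` ends the path.
    · refine ⟨Sum.inr 0, ?_, by simp⟩
      obtain rfl | rfl : h = 0 ∨ h = 1 := by omega
      · rcases w with h' | j
        · simp only [rank'] at hw
          split_ifs at hw <;> simp_all
          omega
        · simp [rank'] at hw; omega
      · simp [rank']; omega
    · exact ⟨Sum.inl 0, by simp [rank'], by simp⟩

/-- The first summand is the depth in the tree of `rank k`, the second that in the tree of `rank'
l`; `hsum` makes the lower bound meet the upper one. -/
theorem diam_eq [NeZero q] (k : Fin q) {l : ℕ} (hl : 0 < l) (hlq : l ≤ q)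
    (hcond : ∀ X : Finset (Fin q),
      X.card.choose 2 + 2 * ∑ i ∈ X, (if k ≤ i then 1 else 0) ≤ 4 * X.card)
    (hcond' : ∀ X : Finset (Fin q),
      X.card.choose 2 + 2 * ∑ i ∈ X, (if i.val < l then 1 else 0) ≤ 4 * X.card)
    (hcond₂ : ∀ X : Finset (Fin q), X.card.choose 2 +
      2 * ∑ i ∈ X, ((if k ≤ i then 1 else 0) + if i.val < l then 1 else 0) ≤ 4 * X.card + 1)
    (hsum : ∑ i : Fin q, ((if k ≤ i then 1 else 0) + if i.val < l then 1 else 0) + q.choose 2 =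
      (4 * q + q.choose 2 + 1) / 2) :
    (rotationGraph (K q)).diam = (4 * q + q.choose 2 + 1) / 2 := by
  obtain ⟨T, hT⟩ := exists_tree_rank k
  obtain ⟨T', hT'⟩ := exists_tree_rank' hl hlq
  have hd : ∀ i, depth T i = if k ≤ i then 1 else 0 := by
    intro i
    have h₀ : (0, i) ∈ above T ↔ k ≤ i := by
      rw [mem_above, hT, Fin.le_def]
      simp only [rank, if_true]
      omega
    have h₁ : (1, i) ∉ above T := by
      rw [mem_above, hT]
      simp [rank]
    simp [depth, h₀, h₁]
  have hd' : ∀ i, depth T' i = if i.val < l then 1 else 0 := by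
    intro i
    have h₀ : (0, i) ∉ above T' := by
      rw [mem_above, hT']
      simp [rank']
    have h₁ : (1, i) ∈ above T' ↔ i.val < l := by
      rw [mem_above, hT']
      simp [rank']
      omega
    simp [depth, h₀, h₁]
  have hlower : ∀ p : (rotationGraph (K q)).Walk T T',
      (4 * q + q.choose 2 + 1) / 2 ≤ p.length := by
    intro p
    rw [← hsum]
    have := length_ge (T := T) (T' := T') (fun i => by rw [hd]; split_ifs <;> simp)
      (fun i => by rw [hd']; split_ifs <;> simp)
      (by rw [hT]; simp [rank]; omega) (by rw [hT']; simp [rank']; omega)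
      (fun i j hij => by rw [hT]; simp [rank]; omega)
      (fun i j hij => by rw [hT']; simp [rank']; omega)
      (by simpa only [hd] using hcond) (by simpa only [hd'] using hcond')
      (by simpa only [hd, hd'] using hcond₂) p
    simpa only [hd, hd'] using this
  -- `diam` is 0 when `ediam` is infinite; the finite value of `ediam` excludes this default.
  have hediam : (rotationGraph (K q)).ediam = ((4 * q + q.choose 2 + 1) / 2 : ℕ) := by
    refine le_antisymm (SimpleGraph.ediam_le_of_edist_le edist_le) ?_
    refine le_trans ?_ (SimpleGraph.edist_le_ediam (u := T) (v := T'))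
    rw [SimpleGraph.edist]
    exact le_iInf fun p => Nat.cast_le.2 (hlower p)
  rw [SimpleGraph.diam, hediam, ENat.toNat_natCast]

end CompleteBipartite

end GraphAssoc

/-! ### The six values of `q`. -/

set_option maxRecDepth 100000 in
theorem mainTheorem12 :
    (GraphAssoc.rotationGraph (completeBipartiteGraph (Fin 2) (Fin 3))).diam = 8 ∧
    (GraphAssoc.rotationGraph (completeBipartiteGraph (Fin 2) (Fin 4))).diam = 11 ∧
    (GraphAssoc.rotationGraph (completeBipartiteGraph (Fin 2) (Fin 5))).diam = 15 ∧
    (GraphAssoc.rotationGraph (completeBipartiteGraph (Fin 2) (Fin 6))).diam = 20 ∧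
    (GraphAssoc.rotationGraph (completeBipartiteGraph (Fin 2) (Fin 7))).diam = 25 ∧
    (GraphAssoc.rotationGraph (completeBipartiteGraph (Fin 2) (Fin 8))).diam = 30 := by
  refine ⟨?_, ?_, ?_, ?_, ?_, ?_⟩
  -- `hsum` prescribes the total depth `(q - k) + l`: it is 5 for `q = 3, 4, 5, 6`, then 4 and 2.
  -- The balance conditions are decided over all subsets of `Fin q`.
  · exact GraphAssoc.CompleteBipartite.diam_eq (q := 3) 0 (l := 2) (by decide) (by decide)
      (by decide) (by decide) (by decide) (by decide)
  · exact GraphAssoc.CompleteBipartite.diam_eq (q := 4) 1 (l := 2) (by decide) (by decide)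
      (by decide) (by decide) (by decide) (by decide)
  · exact GraphAssoc.CompleteBipartite.diam_eq (q := 5) 3 (l := 3) (by decide) (by decide)
      (by decide) (by decide) (by decide) (by decide)
  · exact GraphAssoc.CompleteBipartite.diam_eq (q := 6) 4 (l := 3) (by decide) (by decide)
      (by decide) (by decide) (by decide) (by decide)
  · exact GraphAssoc.CompleteBipartite.diam_eq (q := 7) 5 (l := 2) (by decide) (by decide)
      (by decide) (by decide) (by decide) (by decide)
  · exact GraphAssoc.CompleteBipartite.diam_eq (q := 8) 7 (l := 1) (by decide) (by decide)
      (by decide) (by decide) (by decide) (by decide)
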